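/- **Setting.** Let $\mathcal X,\mathcal U,\mathcal A$ be finite sets ($\mathcal U,\mathcal A\neq\emptyset$), $f:\mathcal X\times\mathcal U\times\mathcal A\to\mathcal X$ deterministic dynamics, $h:\mathcal X\to\mathbb R$ a constraint function, $r:\mathcal X\times\mathcal U\times\mathcal A\to\mathbb R$ a reward, $\gamma\in[0,1)$ and $\gamma_h\in(0,1)$ discount factors. Policies are stationary maps $\pi:\mathcal X\to\Delta(\mathcal U)$ (protagonist) and $\mu:\mathcal X\to\Delta(\mathcal A)$ (adversary). *Safety values.* For a protagonist policy $\pi$ let $Q_{\mathrm{safe}}^{\pi}(x,u,a)=\min_\mu\min_\tau\min_{t\ge0}h(x_t)$, where $\tau=(x_t,u_t,a_t)_{t\ge 0}$ ranges over the trajectories with $(x_0,u_0,a_0)=(x,u,a)$, $x_{t+1}=f(x_t,u_t,a_t)$ and, for $t\ge1$, $\pi(u_t|x_t)>0$, $\mu(a_t|x_t)>0$. Let $Q_{\mathrm{safe}}^{*}=\max_\pi Q_{\mathrm{safe}}^{\pi}$ and $V_h^\pi(x)=\max_u\min_aQ_{\mathrm{safe}}^{\pi}(x,u,a)$. For $Q:\mathcal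 X\times\mathcal U\times\mathcal A\to\mathbb R$ put $S(Q)=\{x:\max_u\min_aQ(x,u,a)\ge0\}$, $U_Q(x)=\{u:\min_aQ(x,u,a)\ge0\}$, and let $\Pi(Q)$ be the set of protagonist policies with $\pi(u|x)=0$ whenever $x\in S(Q)$, $u\notin U_Q(x)$. Assume that the maximal robust invariant set $S(Q_{\mathrm{safe}}^{*})$ is nonempty. With $x'=f(x,u,a)$ and $\sigma:\mathcal X\to\mathcal U$ a deterministic policy, let $$[T_h^{\sigma}Q](x,u,a)=(1-\gamma_h)h(x)+\gamma_h\min\{h(x),\min_{a'}Q(x',\sigma(x'),a')\},$$ $$[T_hQ](x,u,a)=(1-\gamma_h)h(x)+\gamma_h\min\{h(x),\max_{u'}\min_{a'}Q(x',u',a')\}.$$ *Performance values.* Let $Q^{\pi,\mu}(x,u,a)=\mathbb E\sum_{t\ge0}\gamma^tr(x_t,u_t,a_t)$ for the chain started at $(x,u,a)$, with $x_{t+1}=f(x_t,u_t,a_t)$ and, for $t\ge1$, independent draws $u_t\sim\pi(\cdot|x_t)$, $a_t\sim\mu(\cdot|x_t)$. Let $Q^\pi=\min_\mu Q^{\pi,\mu}$,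 $V^\pi(x)=\min_a\sum_u\pi(u|x)Q^\pi(x,u,a)$ and $$[T^\pi Q](x,u,a)=r(x,u,a)+\gamma\min_{a'}\sum_{u'}\pi(u'|x')Q(x',u',a').$$ *Twofold problem.* Let $Q_h^*$ be the fixed point of $T_h$ and $S^*=S(Q_h^*)$. For a distribution $d$ of $x_0$ on $\mathcal X$, maximize over $\pi$ $$J_d(\pi)=\mathbb E_{x_0\sim d}\{V^\pi(x_0)\mathbb 1_{S^*}(x_0)+V_h^\pi(x_0)\mathbb 1_{\mathcal X\setminus S^*}(x_0)\}$$ subject to: along every trajectory with $d(x_0)>0$, $\pi(u_t|x_t)>0$, $x_{t+1}=f(x_t,u_t,a_t)$ ($t\ge0$) and arbitrary adversary actions $a_t$, one has $\min_aQ_h^*(x_t,u_t,a)\ge0$ whenever $x_t\in S^*$. *Dual policy iteration.* Fix $n\ge1$, an initial task policy $\pi_0$ and an initial deterministic safety policy $\sigma$. In each outer iteration: (i) repeat $n$ times: solve $T_h^{\sigma}Q_h^{\sigma}=Q_h^{\sigma}$, then replace $\sigma(x)$, for every $x$, by an element of $\arg\max_u\min_aQ_h^{\sigma}(x,u,a)$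 (in the first outer iteration this block of $n$ steps is repeated until $S(Q_h^{\sigma})\ne\emptyset$ for the current $\sigma$); (ii) solve $T^\pi Q=Q$ for the current task policy $\pi$; (iii) for $x\in S(Q_h^\sigma)$ replace $\pi(\cdot|x)$ by a maximizer of $\min_a\sum_u\rho(u)Q(x,u,a)$ over the distributions $\rho$ carried by $U_{Q_h^\sigma}(x)$; for $x\notin S(Q_h^\sigma)$ let $\pi(\cdot|x)$ be the point mass at $\sigma(x)$. Ties in $\arg\max$ are broken arbitrarily. Let $\sigma_k$ be the safety policy after $k$ safety improvements, and $\pi_m$ the task policy after $m$ outer iterations. **Theorem.** There is $\gamma_0<1$, depending only on $\mathcal X,\mathcal U,\mathcal A,f,h$, such that the following holds for all $\gamma_h\in(0,1)$, $r$, $\gamma\in[0,1)$, $n\ge1$ and all initial policies. 1. $T_h$ has a unique fixed point $Q_h^*$, the algorithm can be executed, and for every run $Q_h^{\sigma_k}\le Q_h^{\sigma_{k+1}}\le Q_h^*$ for all $k$, with $Q_h^{\sigma_k}=Q_h^*$ for all large $k$. Hence $S(Q_h^{\sigma_k})\subseteq S(Q_h^{\sigma_{k+1}})$ for all $k$ and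 $S(Q_h^{\sigma_k})=S^*$ for all large $k$. 2. If moreover $\gamma_h>\gamma_0$, then $S^*=S(Q_{\mathrm{safe}}^*)$ and $U_{Q_h^*}=U_{Q_{\mathrm{safe}}^*}$, and for every run: (a) for all large $m$, $\pi_m\in\Pi(Q_h^*)$, and outside $S^*$ the policy $\pi_m$ equals the current safety policy $\sigma$, for which $Q_h^\sigma=Q_h^*$; (b) for every $x\in S^*$, the maximum $\max_{\pi\in\Pi(Q_h^*)}V^\pi(x)$ exists and $V^{\pi_m}(x)$ converges to it as $m\to\infty$; (c) for all large $m$ and all $x\notin S^*$, $V_h^{\pi_m}(x)=\max_\pi V_h^\pi(x)$; (d) for every distribution $d$, the twofold problem has a solution, $\pi_m$ is feasible for all large $m$, $J_d(\pi_m)$ converges to the optimal value, and the distance from $\pi_m$ to the set of solutions tends to $0$. -/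

import Mathlib

open Filter Topology

namespace ConstrainedGame

/-- A stationary (stochastic) policy `S → Δ(B)`: `p x b` is the probability of choosing `b` at `x`.
Used both for the protagonist (`B = U`) and for the adversary (`B = A`). -/
abbrev Policy (S B : Type*) [Fintype B] := S → stdSimplex ℝ B

/-- Action-value functions. -/
abbrev ActionValue (X U A : Type*) := X → U → A → ℝ

section Definitions

variable {X U A : Type*} [Fintype U] [Fintype A]

/-! ### Undiscounted safety values

All maxima and minima below are over finite sets, or over families of numbers `h x` with `x`
in the finite state space, so that `⨆` and `⨅` are genuine suprema and infima. -/

/-- `τ = (x₀,u₀,a₀), (x₁,u₁,a₁), …` is a trajectory that starts from `(x,u,a)` and lies in the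
support of the trajectory distribution generated by `π` and `μ`: from time `1` on, every action
has positive probability. -/
def IsTrajectory (f : X → U → A → X) (π : Policy X U) (μ : Policy X A) (x : X) (u : U) (a : A)
    (τ : ℕ → X × U × A) : Prop :=
  τ 0 = (x, u, a) ∧
  ∀ t, (τ (t + 1)).1 = f (τ t).1 (τ t).2.1 (τ t).2.2 ∧
    0 < π (τ (t + 1)).1 (τ (t + 1)).2.1 ∧
    0 < μ (τ (t + 1)).1 (τ (t + 1)).2.2

/-- Safety value of a trajectory: the least constraint value along it. -/
noncomputable def trajSafety (h : X → ℝ) (τ : ℕ → X × U × A) : ℝ := ⨅ t, h (τ t).1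

/-- Safety value of a pair of policies: the worst trajectory in the support. -/
noncomputable def pairSafety (f : X → U → A → X) (h : X → ℝ) (π : Policy X U) (μ : Policy X A) :
    ActionValue X U A :=
  fun x u a => ⨅ τ : {τ : ℕ → X × U × A // IsTrajectory f π μ x u a τ}, trajSafety h τ.1

/-- Safety value of a protagonist policy: the worst adversary policy. -/
noncomputable def policySafety (f : X → U → A → X) (h : X → ℝ) (π : Policy X U) :
    ActionValue X U A :=
  fun x u a => ⨅ μ : Policy X A, pairSafety f h π μ x u a

/-- Optimal safety value: the best protagonist policy. -/
noncomputable def optimalSafety (f : X → U → A → X) (h : X → ℝ) : ActionValue X U A :=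
  fun x u a => ⨆ π : Policy X U, policySafety f h π x u a

/-- Safety state-value `max_u min_a` of the safety value of a policy. -/
noncomputable def stateSafety (f : X → U → A → X) (h : X → ℝ) (π : Policy X U) (x : X) : ℝ :=
  ⨆ u, ⨅ a, policySafety f h π x u a

/-! ### Robust invariant sets and invariant policies attached to a safety value function -/

/-- `{x | max_u min_a Q(x,u,a) ≥ 0}`. -/
def robustSet (Q : ActionValue X U A) : Set X := {x | 0 ≤ ⨆ u, ⨅ a, Q x u a}

/-- Admissible actions at `x`: `{u | min_a Q(x,u,a) ≥ 0}`. -/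
def admissible (Q : ActionValue X U A) (x : X) : Set U := {u | 0 ≤ ⨅ a, Q x u a}

/-- Policies that use only admissible actions at the states of `robustSet Q`. -/
def invariantPolicies (Q : ActionValue X U A) : Set (Policy X U) :=
  {π | ∀ x ∈ robustSet Q, ∀ u, u ∉ admissible Q x → π x u = 0}

/-! ### Discounted safety operators -/

/-- Safety self-consistency operator of a deterministic protagonist policy `σ`. -/
noncomputable def safetyPolicyOp (f : X → U → A → X) (h : X → ℝ) (γh : ℝ) (σ : X → U)
    (Q : ActionValue X U A) : ActionValue X U A :=
  fun x u a => (1 - γh) * h x + γh * min (h x) (⨅ a', Q (f x u a) (σ (f x u a)) a')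

/-- Safety Bellman operator. -/
noncomputable def safetyBellmanOp (f : X → U → A → X) (h : X → ℝ) (γh : ℝ)
    (Q : ActionValue X U A) : ActionValue X U A :=
  fun x u a => (1 - γh) * h x + γh * min (h x) (⨆ u', ⨅ a', Q (f x u a) u' a')

/-! ### Performance values -/

/-- One-step conditional expectation: `(x,u,a) ↦ E[g(x₁,u₁,a₁)]` for the controlled chain started
from `(x₀,u₀,a₀) = (x,u,a)`, where `x₁ = f(x,u,a)`, `u₁ ∼ π(·|x₁)` and `a₁ ∼ μ(·|x₁)` are drawn
independently. Its `t`-th iterate is `(x,u,a) ↦ E[g(x_t,u_t,a_t)]`. -/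
noncomputable def stepExpectation (f : X → U → A → X) (π : Policy X U) (μ : Policy X A)
    (g : ActionValue X U A) : ActionValue X U A :=
  fun x u a => ∑ u', π (f x u a) u' * ∑ a', μ (f x u a) a' * g (f x u a) u' a'

/-- Expected discounted total reward of a pair of policies, started from `(x,u,a)`. -/
noncomputable def pairValue (f : X → U → A → X) (r : ActionValue X U A) (γ : ℝ)
    (π : Policy X U) (μ : Policy X A) : ActionValue X U A :=
  fun x u a => ∑' t : ℕ, γ ^ t * ((stepExpectation f π μ)^[t] r) x u a

/-- Worst-case value of a protagonist policy over all adversary policies. -/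
noncomputable def policyValue (f : X → U → A → X) (r : ActionValue X U A) (γ : ℝ)
    (π : Policy X U) : ActionValue X U A :=
  fun x u a => ⨅ μ : Policy X A, pairValue f r γ π μ x u a

/-- Worst-case state value; the adversary does not observe the action drawn from `π(·|x)`. -/
noncomputable def stateValue (f : X → U → A → X) (r : ActionValue X U A) (γ : ℝ)
    (π : Policy X U) (x : X) : ℝ :=
  ⨅ a, ∑ u, π x u * policyValue f r γ π x u a

/-- Performance self-consistency operator of a protagonist policy. -/
noncomputable def performanceOp (f : X → U → A → X) (r : ActionValue X U A) (γ : ℝ)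
    (π : Policy X U) (Q : ActionValue X U A) : ActionValue X U A :=
  fun x u a => r x u a + γ * ⨅ a', ∑ u', π (f x u a) u' * Q (f x u a) u' a'

/-! ### The twofold constrained problem -/

/-- Constraint of the problem for initial distribution `d` and optimal safety value `Qs`: along every
trajectory generated by `π` from the support of `d`, whatever the adversary actions, each action
`u_t` used at a state `x_t` of the maximal robust invariant set has `min_a Qs(x_t,u_t,a) ≥ 0`. -/
def Feasible [Fintype X] (f : X → U → A → X) (d : stdSimplex ℝ X) (Qs : ActionValue X U A)
    (π : Policy X U) : Prop :=
  ∀ τ : ℕ → X × U × A, 0 < d (τ 0).1 →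
    (∀ t, (τ (t + 1)).1 = f (τ t).1 (τ t).2.1 (τ t).2.2) →
    (∀ t, 0 < π (τ t).1 (τ t).2.1) →
    ∀ t, (τ t).1 ∈ robustSet Qs → 0 ≤ ⨅ a, Qs (τ t).1 (τ t).2.1 a

/-- Twofold objective: expected worst-case reward inside the maximal robust invariant set, expected
safety value outside. -/
noncomputable def objective [Fintype X] (f : X → U → A → X) (h : X → ℝ) (r : ActionValue X U A)
    (γ : ℝ) (d : stdSimplex ℝ X) (Qs : ActionValue X U A) (π : Policy X U) : ℝ :=
  ∑ x, d x * ((robustSet Qs).indicator (stateValue f r γ π) x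
    + (robustSet Qs)ᶜ.indicator (stateSafety f h π) x)

/-- Solutions: feasible policies whose objective is maximal among all feasible policies. -/
def solutions [Fintype X] (f : X → U → A → X) (h : X → ℝ) (r : ActionValue X U A)
    (γ : ℝ) (d : stdSimplex ℝ X) (Qs : ActionValue X U A) : Set (Policy X U) :=
  {π | Feasible f d Qs π ∧
    ∀ π', Feasible f d Qs π' → objective f h r γ d Qs π' ≤ objective f h r γ d Qs π}

/-! ### Dual policy iteration -/

/-- `σ'(x) ∈ argmax_u min_a Qh(x,u,a)` for every state `x`. -/
def IsSafetyImprovement (Qh : ActionValue X U A) (σ' : X → U) : Prop :=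
  ∀ x u, ⨅ a, Qh x u a ≤ ⨅ a, Qh x (σ' x) a

/-- Task policy improvement, from the task value `Q` and from a safety policy `σ` with safety value
`Qh`. Inside `robustSet Qh`, the new distribution at `x` solves the matrix game
`max_ρ min_a ∑_u ρ(u) Q(x,u,a)` over the distributions `ρ` carried by the admissible actions;
outside, the safety policy is copied. -/
def IsTaskImprovement (Q Qh : ActionValue X U A) (σ : X → U) (π' : Policy X U) : Prop :=
  (∀ x ∈ robustSet Qh,
    (∀ u, u ∉ admissible Qh x → π' x u = 0) ∧
    ∀ ρ : stdSimplex ℝ U, (∀ u, u ∉ admissible Qh x → ρ u = 0) →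
      ⨅ a, ∑ u, ρ u * Q x u a ≤ ⨅ a, ∑ u, π' x u * Q x u a) ∧
  ∀ x, x ∉ robustSet Qh → π' x (σ x) = 1

/-- A run of dual policy iteration with `n` safety iterations per outer iteration, continued for all
outer iterations (stopping after `m` of them returns `π m`); ties in argmax are broken arbitrarily.

* `σ k` is the safety policy after `k` safety improvements and `Qh k` its evaluation.
* `π j` is the task policy after `j` outer iterations and `Q j` its evaluation.
* `K` is the number of times the block of `n` safety iterations is executed in the first outer
  iteration: it is repeated until the robust invariant set of the current safety policy is nonempty.
  Every later outer iteration executes one block, so that outer iteration number `j + 1` improves the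
  task policy with the safety policy `σ ((K + j) * n)`. -/
structure IsRun (f : X → U → A → X) (h : X → ℝ) (r : ActionValue X U A) (γh γ : ℝ) (n : ℕ)
    (π₀ : Policy X U) (σ₀ : X → U)
    (π : ℕ → Policy X U) (Q : ℕ → ActionValue X U A)
    (σ : ℕ → X → U) (Qh : ℕ → ActionValue X U A) (K : ℕ) : Prop where
  task_init : π 0 = π₀
  safety_init : σ 0 = σ₀
  safety_evaluation : ∀ k, safetyPolicyOp f h γh (σ k) (Qh k) = Qh k
  safety_improvement : ∀ k, IsSafetyImprovement (Qh k) (σ (k + 1))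
  first_pos : 1 ≤ K
  first_check : (robustSet (Qh (K * n))).Nonempty
  first_least : ∀ i, 1 ≤ i → i < K → robustSet (Qh (i * n)) = ∅
  task_evaluation : ∀ j, performanceOp f r γ (π j) (Q j) = Q j
  task_improvement : ∀ j,
    IsTaskImprovement (Q j) (Qh ((K + j) * n)) (σ ((K + j) * n)) (π (j + 1))

end Definitions

end ConstrainedGame

open ConstrainedGame

open ConstrainedGame

set_option linter.unusedSectionVars false

namespace ConstrainedGame

/-! ### Finite suprema and infima -/

section FiniteExtrema

/-! Every operator involved is monotone and shrinks added constants by its discount factor, so a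
subsolution lies below a supersolution. The comparison also works on a set of triples closed under
the relevant moves (`le_of_contraction`), and nearly all inequalities below are instances of it.

Safety iteration: evaluations increase and stay below `Qs`, the fixed point of the safety Bellman
operator. As there are finitely many deterministic policies, one repeats; the evaluation is then
stationary, hence equal to `Qs` (`safety_iteration_eventually_eq`).

Threshold: fix a level `c`. The triples from which the adversary forces `h < c` form an attractor
reached in finitely many rounds `N`. Off it the discounted value is at least `c`; on it the value is
at most `H - γh ^ N * (H - b)`, which is below `c` for `γh` near `1`. So `{Qs ≥ c}` is the
complement of the attractor and the protagonist can maintain it (`eventually_isViable`).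
Undiscounted safety values lie in the finite range of `h`, so the levels `0` and `h y` suffice and
one threshold serves all. A policy that is admissible inside the robust set and greedy outside then
preserves each of these levels `c ≤ 0`. This gives equality of the robust sets and optimality
outside.

Performance: viability at level `0` makes the robust set with its admissible actions a closed
subgame. Once the safety value is `Qs`, task iteration is policy iteration in this subgame, with gap
to its Bellman fixed point `Qo` shrinking by `γ` per step (`task_iteration_contract`).

Twofold problem: feasible policies are bounded pointwise by the subgame value inside and by the best
safety value outside, and `optimalPolicies` attain both bounds at once. Convergence in distance
follows by compactness: every limit point of the task policies is optimal. -/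

lemma iInf_mem_of_finite {ι : Type*} [Nonempty ι] {s : Set ℝ} (hs : s.Finite)
    {p : ι → ℝ} (hp : ∀ i, p i ∈ s) : iInf p ∈ s :=
  Set.range_subset_iff.2 hp
    ((Set.range_nonempty p).csInf_mem (hs.subset (Set.range_subset_iff.2 hp)))

variable {ι : Type*} [Finite ι]

lemma iInf_le_of_finite (p : ι → ℝ) (i : ι) : iInf p ≤ p i :=
  ciInf_le (Finite.bddBelow_range p) i

lemma le_iSup_of_finite (p : ι → ℝ) (i : ι) : p i ≤ iSup p :=
  le_ciSup (Finite.bddAbove_range p) i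

variable [Nonempty ι]

lemma le_iInf_iff_of_finite {p : ι → ℝ} {c : ℝ} : c ≤ iInf p ↔ ∀ i, c ≤ p i :=
  le_ciInf_iff (Finite.bddBelow_range p)

lemma le_iSup_iff_of_finite {p : ι → ℝ} {c : ℝ} : c ≤ iSup p ↔ ∃ i, c ≤ p i := by
  constructor
  · intro hc
    obtain ⟨i, hi⟩ := exists_eq_ciSup_of_finite (f := p)
    exact ⟨i, hi ▸ hc⟩
  · rintro ⟨i, hi⟩
    exact hi.trans (le_iSup_of_finite p i)

lemma iInf_le_iInf_add {p q : ι → ℝ} {c : ℝ} (hpq : ∀ i, p i ≤ q i + c) :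
    iInf p ≤ iInf q + c := by
  rw [← sub_le_iff_le_add]
  exact le_ciInf fun i => by linarith [iInf_le_of_finite p i, hpq i]

lemma iSup_le_iSup_add {p q : ι → ℝ} {c : ℝ} (hpq : ∀ i, p i ≤ q i + c) :
    iSup p ≤ iSup q + c :=
  ciSup_le fun i => (hpq i).trans (by linarith [le_iSup_of_finite q i])

end FiniteExtrema

/-! ### Contractive operators on action-value functions -/

section Contraction

variable {X U A : Type*}

/-- Iterating `H` from a crude bound `B` gives the excess `γ ^ n * max B 0` on `D`, which vanishes
in the limit. The predicate `D` allows comparison on a closed subgame only. -/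
lemma le_of_contraction [Finite X] [Finite U] [Finite A] {γ : ℝ} (h0 : 0 ≤ γ) (h1 : γ < 1)
    {D : X → U → A → Prop} {P Q : ActionValue X U A}
    (H : ∀ c, 0 ≤ c → (∀ x u a, D x u a → P x u a ≤ Q x u a + c) →
      ∀ x u a, D x u a → P x u a ≤ Q x u a + γ * c) :
    ∀ x u a, D x u a → P x u a ≤ Q x u a := by
  obtain ⟨B, hB⟩ := Finite.bddAbove_range
    (fun i : X × U × A => P i.1 i.2.1 i.2.2 - Q i.1 i.2.1 i.2.2)
  have key : ∀ n : ℕ, ∀ x u a, D x u a → P x u a ≤ Q x u a + γ ^ n * max B 0 := by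
    intro n
    induction n with
    | zero =>
      intro x u a _
      have := hB ⟨(x, u, a), rfl⟩
      simp only at this
      linarith [le_max_left B 0]
    | succ n ih =>
      intro x u a hD
      have := H _ (by positivity) ih x u a hD
      rwa [← mul_assoc, ← pow_succ'] at this
  intro x u a hD
  have hlim : Tendsto (fun n : ℕ => Q x u a + γ ^ n * max B 0) atTop (𝓝 (Q x u a + 0 * max B 0)) :=
    ((tendsto_pow_atTop_nhds_zero_of_lt_one h0 h1).mul_const _).const_add _
  rw [zero_mul, add_zero] at hlim
  exact ge_of_tendsto' hlim fun n => key n x u a hD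

/-- Monotone operators that discount constants by the factor `γ`. -/
def IsDiscounting (γ : ℝ) (T : ActionValue X U A → ActionValue X U A) : Prop :=
  ∀ P Q c, 0 ≤ c → (∀ x u a, P x u a ≤ Q x u a + c) → ∀ x u a, T P x u a ≤ T Q x u a + γ * c

lemma IsDiscounting.le_of_sub_super [Finite X] [Finite U] [Finite A] {γ : ℝ} (h0 : 0 ≤ γ)
    (h1 : γ < 1) {T : ActionValue X U A → ActionValue X U A} (hT : IsDiscounting γ T)
    {P Q : ActionValue X U A} (hP : P ≤ T P) (hQ : T Q ≤ Q) : P ≤ Q := by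
  intro x u a
  refine le_of_contraction h0 h1 (D := fun _ _ _ => True) (P := P) (Q := Q) ?_ x u a trivial
  intro c hc hPQ x u a _
  exact (hP x u a).trans ((hT P Q c hc (fun x u a => hPQ x u a trivial) x u a).trans
    (by linarith [hQ x u a]))

lemma IsDiscounting.exists_fixed [Fintype X] [Fintype U] [Fintype A] {γ : ℝ} (h0 : 0 ≤ γ)
    (h1 : γ < 1) {T : ActionValue X U A → ActionValue X U A} (hT : IsDiscounting γ T) :
    ∃ Q, T Q = Q := by
  have hc : ContractingWith ⟨γ, h0⟩ T := by
    refine ⟨by exact_mod_cast h1, LipschitzWith.of_dist_le_mul fun P Q => ?_⟩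
    have hPQ : ∀ x u a, |P x u a - Q x u a| ≤ dist P Q := fun x u a =>
      ((dist_le_pi_dist (P x u) (Q x u) a).trans (dist_le_pi_dist (P x) (Q x) u)).trans
        (dist_le_pi_dist P Q x)
    have hnn : 0 ≤ γ * dist P Q := mul_nonneg h0 dist_nonneg
    change dist (T P) (T Q) ≤ γ * dist P Q
    refine (dist_pi_le_iff hnn).2 fun x => (dist_pi_le_iff hnn).2 fun u =>
      (dist_pi_le_iff hnn).2 fun a => ?_
    rw [Real.dist_eq, abs_le]
    have h₁ := hT P Q _ dist_nonneg
      (fun x u a => by linarith [(abs_le.1 (hPQ x u a)).2]) x u a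
    have h₂ := hT Q P _ dist_nonneg
      (fun x u a => by linarith [(abs_le.1 (hPQ x u a)).1]) x u a
    constructor <;> linarith
  exact ⟨_, hc.fixedPoint_isFixedPt⟩

lemma IsDiscounting.fixed_unique [Finite X] [Finite U] [Finite A] {γ : ℝ} (h0 : 0 ≤ γ)
    (h1 : γ < 1) {T : ActionValue X U A → ActionValue X U A} (hT : IsDiscounting γ T)
    {P Q : ActionValue X U A} (hP : T P = P) (hQ : T Q = Q) : P = Q :=
  le_antisymm (hT.le_of_sub_super h0 h1 hP.ge hQ.le) (hT.le_of_sub_super h0 h1 hQ.ge hP.le)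

end Contraction

/-! ### Safety values: robust sets, discounted operators, trajectories. -/

section Game

variable {X U A : Type*} [Fintype U] [Fintype A] [Nonempty U] [Nonempty A]
  {f : X → U → A → X} {h : X → ℝ} {γh : ℝ}

/-! ### Robust sets -/

lemma mem_admissible_iff {Q : ActionValue X U A} {x : X} {u : U} :
    u ∈ admissible Q x ↔ ∀ a, 0 ≤ Q x u a :=
  le_iInf_iff_of_finite

lemma mem_robustSet_iff {Q : ActionValue X U A} {x : X} :
    x ∈ robustSet Q ↔ ∃ u, ∀ a, 0 ≤ Q x u a :=
  le_iSup_iff_of_finite.trans (exists_congr fun _ => le_iInf_iff_of_finite)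

lemma robustSet_mono {P Q : ActionValue X U A} (hPQ : P ≤ Q) : robustSet P ⊆ robustSet Q := by
  intro x hx
  obtain ⟨u, hu⟩ := mem_robustSet_iff.1 hx
  exact mem_robustSet_iff.2 ⟨u, fun a => (hu a).trans (hPQ x u a)⟩

lemma exists_isSafetyImprovement (Q : ActionValue X U A) : ∃ σ, IsSafetyImprovement Q σ := by
  choose σ hσ using fun x => Finite.exists_max fun u => ⨅ a, Q x u a
  exact ⟨σ, hσ⟩

lemma IsSafetyImprovement.iInf_eq {Q : ActionValue X U A} {σ : X → U}
    (hσ : IsSafetyImprovement Q σ) (x : X) : ⨅ a, Q x (σ x) a = ⨆ u, ⨅ a, Q x u a :=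
  le_antisymm (le_iSup_of_finite (fun u => ⨅ a, Q x u a) (σ x)) (ciSup_le (hσ x))

/-! ### Discounted safety operators -/

lemma safetyOp_le_add (hγ : 0 ≤ γh) {y p q c : ℝ} (hc : 0 ≤ c) (hpq : p ≤ q + c) :
    (1 - γh) * y + γh * min y p ≤ (1 - γh) * y + γh * min y q + γh * c := by
  have : min y p ≤ min y q + c := by
    rw [← min_add_add_right]
    exact min_le_min (by linarith) hpq
  nlinarith [mul_le_mul_of_nonneg_left this hγ]

lemma le_safetyOp (h0 : 0 ≤ γh) (h1 : γh ≤ 1) {v y p : ℝ} (hy : v ≤ y) (hp : v ≤ p) :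
    v ≤ (1 - γh) * y + γh * min y p := by
  linarith [mul_le_mul_of_nonneg_left (le_min hy hp) h0,
    mul_le_mul_of_nonneg_left hy (sub_nonneg.2 h1)]

lemma isDiscounting_safetyPolicyOp (hγ : 0 ≤ γh) (σ : X → U) :
    IsDiscounting γh (safetyPolicyOp (A := A) f h γh σ) := fun _ _ _ hc hPQ _ _ _ =>
  safetyOp_le_add hγ hc (iInf_le_iInf_add fun a => hPQ _ _ a)

lemma isDiscounting_safetyBellmanOp (hγ : 0 ≤ γh) :
    IsDiscounting γh (safetyBellmanOp (A := A) f h γh) := fun _ _ _ hc hPQ _ _ _ =>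
  safetyOp_le_add hγ hc (iSup_le_iSup_add fun _ => iInf_le_iInf_add fun a => hPQ _ _ a)

lemma safetyPolicyOp_le_bellman (hγ : 0 ≤ γh) (σ : X → U) (Q : ActionValue X U A) :
    safetyPolicyOp f h γh σ Q ≤ safetyBellmanOp f h γh Q := fun x u a => by
  have := le_iSup_of_finite (fun u' => ⨅ a', Q (f x u a) u' a') (σ (f x u a))
  exact (safetyOp_le_add (y := h x) hγ le_rfl (this.trans (add_zero _).ge)).trans_eq
    (by simp [safetyBellmanOp])

lemma IsSafetyImprovement.safetyPolicyOp_eq {Q : ActionValue X U A} {σ : X → U}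
    (hσ : IsSafetyImprovement Q σ) :
    safetyPolicyOp f h γh σ Q = safetyBellmanOp f h γh Q := by
  funext x u a
  simp only [safetyPolicyOp, safetyBellmanOp, hσ.iInf_eq]

lemma le_constraint_of_fixed (hγ : 0 ≤ γh) {Q : ActionValue X U A}
    (hQ : safetyBellmanOp f h γh Q = Q) (x : X) (u : U) (a : A) : Q x u a ≤ h x := by
  rw [← hQ]
  have := mul_le_mul_of_nonneg_left
    (min_le_left (h x) (⨆ u', ⨅ a', Q (f x u a) u' a')) hγ
  simp only [safetyBellmanOp]
  linarith

/-! ### Trajectories -/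

/-- Trajectories that follow the dynamics and the support of `π` from time `0` on, against arbitrary
adversary actions. -/
def IsPath (f : X → U → A → X) (π : Policy X U) (τ : ℕ → X × U × A) : Prop :=
  (∀ t, (τ (t + 1)).1 = f (τ t).1 (τ t).2.1 (τ t).2.2) ∧ ∀ t, 0 < π (τ t).1 (τ t).2.1

/-- Prepend a triple to a trajectory. -/
def consPath (i : X × U × A) (τ : ℕ → X × U × A) : ℕ → X × U × A
  | 0 => i
  | t + 1 => τ t

lemma exists_pos (ρ : stdSimplex ℝ U) : ∃ u, 0 < ρ u := by
  by_contra! hρ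
  have := stdSimplex.sum_eq_one ρ
  linarith [Finset.sum_nonpos fun u (_ : u ∈ Finset.univ) => hρ u]

lemma exists_isPath (f : X → U → A → X) (π : Policy X U) (x : X) :
    ∃ τ, IsPath f π τ ∧ (τ 0).1 = x := by
  choose g hg using fun x => exists_pos (π x)
  let a₀ : A := Classical.arbitrary A
  let s : ℕ → X := fun t => (fun y => f y (g y) a₀)^[t] x
  refine ⟨fun t => (s t, g (s t), a₀), ⟨fun t => ?_, fun t => hg _⟩, rfl⟩
  simp only [s, Function.iterate_succ_apply']

lemma IsPath.cons {π : Policy X U} {τ : ℕ → X × U × A} (hτ : IsPath f π τ) {x : X} {u : U} {a : A}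
    (h0 : (τ 0).1 = f x u a) (hu : 0 < π x u) : IsPath f π (consPath (x, u, a) τ) := by
  refine ⟨fun t => ?_, fun t => ?_⟩
  · cases t with
    | zero => exact h0
    | succ t => exact hτ.1 t
  · cases t with
    | zero => exact hu
    | succ t => exact hτ.2 t

/-- The uniform adversary has full support, so its trajectories include those of every other
adversary. This allows trajectories generated by different adversaries to be glued together. -/
lemma barycenter_pos (a : A) : 0 < (stdSimplex.barycenter : stdSimplex ℝ A) a := by
  change 0 < (Fintype.card A : ℝ)⁻¹
  have : 0 < Fintype.card A := Fintype.card_pos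
  positivity

/-! ### Undiscounted safety values -/

lemma exists_isTrajectory (f : X → U → A → X) (π : Policy X U) (μ : Policy X A)
    (x : X) (u : U) (a : A) : ∃ τ, IsTrajectory f π μ x u a τ := by
  choose g hg using fun x => exists_pos (π x)
  choose k hk using fun x => exists_pos (μ x)
  let s : ℕ → X := fun t => (fun y => f y (g y) (k y))^[t] (f x u a)
  refine ⟨consPath (x, u, a) fun t => (s t, g (s t), k (s t)), rfl, fun t => ?_⟩
  refine ⟨?_, hg _, hk _⟩
  cases t with
  | zero => rfl
  | succ t => simp only [consPath, s, Function.iterate_succ_apply']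

variable [Finite X]

lemma trajSafety_le (h : X → ℝ) (τ : ℕ → X × U × A) (t : ℕ) : trajSafety h τ ≤ h (τ t).1 :=
  ciInf_le ((Finite.bddBelow_range h).mono (Set.range_comp_subset_range (fun t => (τ t).1) h)) t

lemma trajSafety_mem (h : X → ℝ) (τ : ℕ → X × U × A) : trajSafety h τ ∈ Set.range h :=
  iInf_mem_of_finite (Set.finite_range h) fun _ => ⟨_, rfl⟩

lemma pairSafety_mem (f : X → U → A → X) (h : X → ℝ) (π : Policy X U) (μ : Policy X A)
    (x : X) (u : U) (a : A) : pairSafety f h π μ x u a ∈ Set.range h := by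
  obtain ⟨τ, hτ⟩ := exists_isTrajectory f π μ x u a
  have : Nonempty {τ : ℕ → X × U × A // IsTrajectory f π μ x u a τ} := ⟨⟨τ, hτ⟩⟩
  exact iInf_mem_of_finite (Set.finite_range h) fun _ => trajSafety_mem h _

lemma policySafety_mem (f : X → U → A → X) (h : X → ℝ) (π : Policy X U)
    (x : X) (u : U) (a : A) : policySafety f h π x u a ∈ Set.range h :=
  iInf_mem_of_finite (Set.finite_range h) fun _ => pairSafety_mem f h π _ x u a

/-- Only finitely many levels occur as safety values, which is why viability at the levels `h y` is
enough. -/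
lemma stateSafety_mem (f : X → U → A → X) (h : X → ℝ) (π : Policy X U) (x : X) :
    stateSafety f h π x ∈ Set.range h := by
  obtain ⟨u, hu⟩ := exists_eq_ciSup_of_finite (f := fun u => ⨅ a, policySafety f h π x u a)
  rw [stateSafety, ← hu]
  exact iInf_mem_of_finite (Set.finite_range h) fun a => policySafety_mem f h π x u a

lemma policySafety_le_trajSafety {π : Policy X U} {μ : Policy X A} {x : X} {u : U} {a : A}
    {τ : ℕ → X × U × A} (hτ : IsTrajectory f π μ x u a τ) :
    policySafety f h π x u a ≤ trajSafety h τ := by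
  have h₁ : policySafety f h π x u a ≤ pairSafety f h π μ x u a :=
    ciInf_le ((Finite.bddBelow_range h).mono
      (Set.range_subset_iff.2 fun μ => pairSafety_mem f h π μ x u a)) μ
  have h₂ : pairSafety f h π μ x u a ≤ trajSafety h τ :=
    ciInf_le (f := fun τ : {τ : ℕ → X × U × A // IsTrajectory f π μ x u a τ} => trajSafety h τ.1)
      ((Finite.bddBelow_range h).mono
        (Set.range_subset_iff.2 fun τ => trajSafety_mem h τ.1)) ⟨τ, hτ⟩
  exact h₁.trans h₂

lemma le_policySafety {π : Policy X U} {x : X} {u : U} {a : A} {c : ℝ}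
    (hc : ∀ μ τ, IsTrajectory f π μ x u a τ → ∀ t, c ≤ h (τ t).1) :
    c ≤ policySafety f h π x u a := by
  refine le_ciInf fun μ => ?_
  obtain ⟨τ, hτ⟩ := exists_isTrajectory f π μ x u a
  have : Nonempty {τ : ℕ → X × U × A // IsTrajectory f π μ x u a τ} := ⟨⟨τ, hτ⟩⟩
  exact le_ciInf fun τ => le_ciInf fun t => hc μ τ.1 τ.2 t

lemma policySafety_le_constraint (π : Policy X U) (x : X) (u : U) (a : A) :
    policySafety f h π x u a ≤ h x := by
  let μ : Policy X A := fun _ => stdSimplex.barycenter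
  obtain ⟨τ, hτ⟩ := exists_isTrajectory f π μ x u a
  have := (policySafety_le_trajSafety (h := h) hτ).trans (trajSafety_le h τ 0)
  rwa [hτ.1] at this

lemma policySafety_le_succ {π : Policy X U} {x : X} {u : U} {a : A} {u' : U}
    (hu' : 0 < π (f x u a) u') (a' : A) :
    policySafety f h π x u a ≤ policySafety f h π (f x u a) u' a' := by
  refine le_policySafety fun μ τ hτ t => ?_
  -- The adversary `μ` is replaced by the uniform one, since `μ` need not charge the action `a'`
  -- that is prolonged.
  have hcons : IsTrajectory f π (fun _ => stdSimplex.barycenter) x u a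
      (consPath (x, u, a) τ) := by
    refine ⟨rfl, fun t => ?_⟩
    cases t with
    | zero =>
      change (τ 0).1 = f x u a ∧ 0 < π (τ 0).1 (τ 0).2.1 ∧ _
      rw [hτ.1]
      exact ⟨rfl, hu', barycenter_pos _⟩
    | succ t => exact ⟨(hτ.2 t).1, (hτ.2 t).2.1, barycenter_pos _⟩
  exact (policySafety_le_trajSafety (h := h) hcons).trans (trajSafety_le h _ (t + 1))

/-- A lower bound for the constraint on a set of triples that is closed under the moves of `π` and
of any adversary is a lower bound for the safety value. -/
lemma le_policySafety_of_closed {π : Policy X U} {c : ℝ} {G : X → U → A → Prop}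
    (hG : ∀ x u a, G x u a → c ≤ h x)
    (hstep : ∀ x u a, G x u a → ∀ u', 0 < π (f x u a) u' → ∀ a', G (f x u a) u' a')
    {x : X} {u : U} {a : A} (hx : G x u a) : c ≤ policySafety f h π x u a := by
  refine le_policySafety fun μ τ hτ t => ?_
  have key : ∀ t, G (τ t).1 (τ t).2.1 (τ t).2.2 := by
    intro t
    induction t with
    | zero => rw [hτ.1]; exact hx
    | succ t ih =>
      have h2 := (hτ.2 t).2.1
      rw [(hτ.2 t).1] at h2 ⊢
      exact hstep _ _ _ ih _ h2 _
  exact hG _ _ _ (key t)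

/-- The undiscounted value is a subsolution for every `γh`: it is at most `h x` and at most the next
state value, hence at most any convex combination of `h x` and their minimum. -/
lemma policySafety_le_of_fixed (h0 : 0 ≤ γh) (h1 : γh < 1) {Q : ActionValue X U A}
    (hQ : safetyBellmanOp f h γh Q = Q) (π : Policy X U) : policySafety f h π ≤ Q := by
  refine (isDiscounting_safetyBellmanOp h0).le_of_sub_super h0 h1 ?_ hQ.le
  intro x u a
  obtain ⟨u', hu'⟩ := exists_pos (π (f x u a))
  have h₁ := policySafety_le_constraint (f := f) (h := h) π x u a
  have h₂ : policySafety f h π x u a ≤ ⨆ u', ⨅ a', policySafety f h π (f x u a) u' a' :=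
    (le_ciInf fun a' => policySafety_le_succ hu' a').trans
      (le_iSup_of_finite (fun u' => ⨅ a', policySafety f h π (f x u a) u' a') u')
  exact le_safetyOp h0 h1.le h₁ h₂

lemma policySafety_le_optimalSafety (π : Policy X U) :
    policySafety f h π ≤ optimalSafety f h := fun x u a =>
  le_ciSup (f := fun π => policySafety f h π x u a)
    ⟨h x, by rintro _ ⟨π, rfl⟩; exact policySafety_le_constraint π x u a⟩ π

lemma optimalSafety_le_of_fixed (h0 : 0 ≤ γh) (h1 : γh < 1) {Q : ActionValue X U A}
    (hQ : safetyBellmanOp f h γh Q = Q) : optimalSafety f h ≤ Q := fun x u a =>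
  ciSup_le fun π => policySafety_le_of_fixed h0 h1 hQ π x u a

end Game

/-! ### Discount threshold, safe policies and safety policy iteration. -/

section Viability

variable {X U A : Type*} [Fintype U] [Fintype A] [Nonempty U] [Nonempty A]
  {f : X → U → A → X} {h : X → ℝ} {γh : ℝ}

/-! ### Level sets of the discounted safety value for discount factors close to one -/

/-- The superlevel set of `Q` at level `c` can be maintained by the protagonist. -/
def IsViable (f : X → U → A → X) (Q : ActionValue X U A) (c : ℝ) : Prop :=
  ∀ x u a, c ≤ Q x u a → ∃ u', ∀ a', c ≤ Q (f x u a) u' a'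

/-- Triples from which the adversary can force the constraint below `c` within `k` steps. -/
def attackSet (f : X → U → A → X) (h : X → ℝ) (c : ℝ) : ℕ → Set (X × U × A)
  | 0 => {i | h i.1 < c}
  | k + 1 => attackSet f h c k ∪
      {i | ∀ u', ∃ a', (f i.1 i.2.1 i.2.2, u', a') ∈ attackSet f h c k}

lemma attackSet_mono (f : X → U → A → X) (h : X → ℝ) (c : ℝ) : Monotone (attackSet f h c) :=
  monotone_nat_of_le_succ fun _ => Set.subset_union_left

variable [Finite X]

lemma exists_attackSet_stable (f : X → U → A → X) (h : X → ℝ) (c : ℝ) :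
    ∃ N, attackSet f h c (N + 1) ⊆ attackSet f h c N := by
  obtain ⟨N, hN⟩ := WellFoundedGT.monotone_chain_condition ⟨_, attackSet_mono f h c⟩
  exact ⟨N, (hN (N + 1) N.le_succ).ge⟩

/-- Each round of the attack costs the adversary one factor `γh` in the deficit below the upper
bound `H`; the deficit is at least `H - b` once the constraint is below `c`. -/
lemma le_attack_bound (h0 : 0 ≤ γh) (h1 : γh < 1) {Q : ActionValue X U A}
    (hQ : safetyBellmanOp f h γh Q = Q) {b c H : ℝ} (hb : ∀ y, h y < c → h y ≤ b)
    (hH : ∀ y, h y ≤ H) (hbH : b ≤ H) (k : ℕ) :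
    ∀ x u a, (x, u, a) ∈ attackSet f h c k → Q x u a ≤ H - γh ^ k * (H - b) := by
  induction k with
  | zero =>
    intro x u a hx
    have := hb x hx
    linarith [le_constraint_of_fixed h0 hQ x u a]
  | succ k ih =>
    intro x u a hx
    rcases hx with hx | hx
    · have hpow : γh ^ (k + 1) ≤ γh ^ k := pow_le_pow_of_le_one h0 h1.le k.le_succ
      linarith [ih x u a hx, mul_le_mul_of_nonneg_right hpow (sub_nonneg.2 hbH)]
    · have hV : ⨆ u', ⨅ a', Q (f x u a) u' a' ≤ H - γh ^ k * (H - b) := by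
        refine ciSup_le fun u' => ?_
        obtain ⟨a', ha'⟩ := hx u'
        exact (iInf_le_of_finite _ a').trans (ih _ _ _ ha')
      have h₁ := mul_le_mul_of_nonneg_left ((min_le_right (h x) _).trans hV) h0
      have h₂ := mul_le_mul_of_nonneg_left (hH x) (sub_nonneg.2 h1.le)
      rw [← hQ]
      simp only [safetyBellmanOp]
      rw [pow_succ']
      linarith

/-- Off a stable attack set `h ≥ c` holds and some action keeps the play off it, so a function equal
to `c` there and very low elsewhere is a subsolution. -/
lemma le_fixed_off_attackSet (h0 : 0 ≤ γh) (h1 : γh < 1) {Q : ActionValue X U A}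
    (hQ : safetyBellmanOp f h γh Q = Q) {c : ℝ} {N : ℕ}
    (hN : attackSet f h c (N + 1) ⊆ attackSet f h c N) {x : X} {u : U} {a : A}
    (hx : (x, u, a) ∉ attackSet f h c N) : c ≤ Q x u a := by
  classical
  obtain ⟨L, hL⟩ := Finite.bddBelow_range h
  -- The floor `min L c` lies below `c` and below every value of `h`, so the subsolution inequality
  -- is automatic on the attack set.
  let P : ActionValue X U A := fun x u a => if (x, u, a) ∈ attackSet f h c N then min L c else c
  have hPL : ∀ x u a, min L c ≤ P x u a := by
    intro x u a
    simp only [P]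
    split_ifs
    exacts [le_rfl, min_le_right _ _]
  have hP : P ≤ Q := by
    refine (isDiscounting_safetyBellmanOp h0).le_of_sub_super h0 h1 (fun x u a => ?_) hQ.le
    refine le_safetyOp h0 h1.le ?_ ?_
    · simp only [P]
      split_ifs with hx
      · exact (min_le_left _ _).trans (hL ⟨x, rfl⟩)
      · by_contra! hc
        exact hx (attackSet_mono f h c N.zero_le hc)
    · simp only [P]
      split_ifs with hx
      · exact le_iSup_iff_of_finite.2 ⟨Classical.arbitrary U, le_ciInf fun a' => hPL _ _ a'⟩
      · have hx' : ∃ u', ∀ a', (f x u a, u', a') ∉ attackSet f h c N := by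
          by_contra! hc
          exact hx (hN (Or.inr hc))
        obtain ⟨u', hu'⟩ := hx'
        exact le_iSup_iff_of_finite.2 ⟨u', le_ciInf fun a' => by rw [if_neg (hu' a')]⟩
  simpa [P, hx] using hP x u a

lemma eventually_isViable (f : X → U → A → X) (h : X → ℝ) (c : ℝ) :
    ∀ᶠ γh in 𝓝 (1 : ℝ), 0 ≤ γh → γh < 1 → ∀ Q : ActionValue X U A,
      safetyBellmanOp f h γh Q = Q → IsViable f Q c := by
  obtain ⟨N, hN⟩ := exists_attackSet_stable f h c
  obtain ⟨H, hH⟩ := Finite.bddAbove_range h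
  -- Finiteness of the range of `h` leaves a gap: some `b < c` dominates all constraint values below
  -- `c`.
  have hb : ∀ᶠ b in 𝓝[<] c, ∀ y, h y < c → h y ≤ b := by
    refine eventually_all.2 fun y => ?_
    by_cases hy : h y < c
    · filter_upwards [Ioo_mem_nhdsLT hy] with b hb _ using hb.1.le
    · exact Eventually.of_forall fun _ hy' => absurd hy' hy
  obtain ⟨b, hb, hbc⟩ := (hb.and self_mem_nhdsWithin).exists
  -- The bound of `le_attack_bound` tends to `b < c` as the discount tends to `1`. Using `max H b`
  -- guarantees that the upper bound is at least `b`.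
  have hlim : Tendsto (fun γ : ℝ => max H b - γ ^ N * (max H b - b)) (𝓝 1)
      (𝓝 (max H b - 1 ^ N * (max H b - b))) := Continuous.tendsto (by fun_prop) 1
  rw [one_pow, one_mul, sub_sub_cancel] at hlim
  filter_upwards [hlim.eventually_lt_const hbc] with γh hγ h0 h1 Q hQ x u a hc
  have hx : (x, u, a) ∉ attackSet f h c N := fun hx => by
    have := le_attack_bound h0 h1 hQ hb (fun y => (hH ⟨y, rfl⟩).trans (le_max_left H b))
      (le_max_right H b) N x u a hx
    linarith
  have hx' : ∃ u', ∀ a', (f x u a, u', a') ∉ attackSet f h c N := by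
    by_contra! hc
    exact hx (hN (Or.inr hc))
  obtain ⟨u', hu'⟩ := hx'
  exact ⟨u', fun a' => le_fixed_off_attackSet h0 h1 hQ hN (hu' a')⟩

/-- There is a threshold beyond which the superlevel sets of the discounted safety value at level
`0` and at all values of the constraint function can be maintained. -/
lemma exists_viability_threshold (f : X → U → A → X) (h : X → ℝ) :
    ∃ γ₀ : ℝ, γ₀ < 1 ∧ ∀ γh, 0 < γh → γh < 1 → γ₀ < γh → ∀ Q : ActionValue X U A,
      safetyBellmanOp f h γh Q = Q → IsViable f Q 0 ∧ ∀ y, IsViable f Q (h y) := by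
  have hev := (eventually_isViable f h 0).and
    (eventually_all.2 fun y => eventually_isViable f h (h y))
  obtain ⟨l, hl, hlu⟩ := mem_nhdsLT_iff_exists_Ioo_subset.1 (mem_nhdsWithin_of_mem_nhds hev)
  refine ⟨l, hl, fun γh h0 h1 hlt Q hQ => ?_⟩
  obtain ⟨h₁, h₂⟩ := hlu ⟨hlt, h1⟩
  exact ⟨h₁ h0.le h1 Q hQ, fun y => h₂ y h0.le h1 Q hQ⟩

/-! ### Policies that stay safe inside the robust set and copy a greedy safety policy outside -/

/-- Invariant policies for `Q` that are greedy and deterministic outside of the robust set. -/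
def safePolicies (Q : ActionValue X U A) : Set (Policy X U) :=
  {π | π ∈ invariantPolicies Q ∧
    ∃ σ, IsSafetyImprovement Q σ ∧ ∀ x, x ∉ robustSet Q → π x (σ x) = 1}

lemma eq_of_pos_of_eq_one {ρ : stdSimplex ℝ U} {u v : U} (hu : ρ u = 1) (hv : 0 < ρ v) :
    v = u := by
  classical
  by_contra huv
  have hsum := stdSimplex.sum_eq_one ρ
  have hle := Finset.sum_le_sum_of_subset_of_nonneg (f := fun i => ρ i)
    (Finset.subset_univ {v, u}) fun i _ _ => stdSimplex.zero_le ρ i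
  rw [Finset.sum_pair huv] at hle
  linarith

variable {Q : ActionValue X U A}

lemma mem_admissible_of_pos {π : Policy X U} (hπ : π ∈ invariantPolicies Q) {x : X}
    (hx : x ∈ robustSet Q) {u : U} (hu : 0 < π x u) : u ∈ admissible Q x := by
  by_contra hn
  exact hu.ne' (hπ x hx u hn)

lemma IsViable.mem_robustSet (hQ : IsViable f Q 0) {x : X} {u : U} (hu : u ∈ admissible Q x)
    (a : A) : f x u a ∈ robustSet Q :=
  mem_robustSet_iff.2 (hQ x u a (mem_admissible_iff.1 hu a))

/-- The set `{c ≤ Q}` is closed under the policy: outside the robust set the greedy action does at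
least as well as the action provided by viability. Inside, admissible actions only guarantee `Q ≥
0`, hence the restriction `c ≤ 0`. -/
lemma le_policySafety_of_mem_safePolicies (hγ : 0 ≤ γh) (hQ : safetyBellmanOp f h γh Q = Q)
    {c : ℝ} (hc : c ≤ 0) (hv : IsViable f Q c) {π : Policy X U} (hπ : π ∈ safePolicies Q)
    {x : X} {u : U} {a : A} (hx : c ≤ Q x u a) : c ≤ policySafety f h π x u a := by
  refine le_policySafety_of_closed (G := fun x u a => c ≤ Q x u a)
    (fun x u a hx => hx.trans (le_constraint_of_fixed hγ hQ x u a)) ?_ hx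
  intro x u a hx u' hu' a'
  obtain ⟨hinv, σ, hσ, hout⟩ := hπ
  by_cases hr : f x u a ∈ robustSet Q
  · exact hc.trans (mem_admissible_iff.1 (mem_admissible_of_pos hinv hr hu') a')
  · obtain rfl := eq_of_pos_of_eq_one (hout _ hr) hu'
    obtain ⟨v, hv⟩ := hv x u a hx
    exact (le_ciInf hv).trans ((hσ _ v).trans (iInf_le_of_finite _ a'))

/-- The value reached by `p` is a level `h y`, is dominated by `Q`, and cannot be positive outside
the robust set; a safe policy therefore preserves that level. -/
lemma stateSafety_le_of_mem_safePolicies (h0 : 0 ≤ γh) (h1 : γh < 1)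
    (hQ : safetyBellmanOp f h γh Q = Q) (hv : ∀ y, IsViable f Q (h y)) {π : Policy X U}
    (hπ : π ∈ safePolicies Q) {x : X} (hx : x ∉ robustSet Q) (p : Policy X U) :
    stateSafety f h p x ≤ stateSafety f h π x := by
  obtain ⟨y, hy⟩ := stateSafety_mem f h p x
  obtain ⟨u, hu⟩ := exists_eq_ciSup_of_finite (f := fun u => ⨅ a, policySafety f h p x u a)
  have hle : ∀ a, stateSafety f h p x ≤ policySafety f h p x u a :=
    fun a => hu.ge.trans (iInf_le_of_finite _ a)
  have hleQ : ∀ a, stateSafety f h p x ≤ Q x u a := fun a =>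
    (hle a).trans (policySafety_le_of_fixed h0 h1 hQ p x u a)
  have hneg : stateSafety f h p x ≤ 0 := by
    by_contra! hpos
    exact hx (mem_robustSet_iff.2 ⟨u, fun a => hpos.le.trans (hleQ a)⟩)
  have := hv y
  rw [hy] at this
  exact le_iSup_iff_of_finite.2 ⟨u, le_ciInf fun a =>
    le_policySafety_of_mem_safePolicies h0 hQ hneg this hπ (hleQ a)⟩

lemma exists_deterministic (σ : X → U) : ∃ π : Policy X U, ∀ x, π x (σ x) = 1 := by
  classical
  exact ⟨fun x => stdSimplex.vertex (σ x), fun x => by simp⟩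

lemma safePolicies_nonempty (Q : ActionValue X U A) : (safePolicies Q).Nonempty := by
  obtain ⟨σ, hσ⟩ := exists_isSafetyImprovement Q
  obtain ⟨π, hπ⟩ := exists_deterministic σ
  refine ⟨π, fun x hx u hu => ?_, σ, hσ, fun x _ => hπ x⟩
  by_contra hne
  have hpos : 0 < π x u := lt_of_le_of_ne (stdSimplex.zero_le _ _) (Ne.symm hne)
  obtain rfl := eq_of_pos_of_eq_one (hπ x) hpos
  obtain ⟨v, hv⟩ := mem_robustSet_iff.1 hx
  exact hu ((le_ciInf hv).trans (hσ x v))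

lemma nonneg_iff_optimalSafety_nonneg (h0 : 0 ≤ γh) (h1 : γh < 1)
    (hQ : safetyBellmanOp f h γh Q = Q) (hv : IsViable f Q 0) (x : X) (u : U) (a : A) :
    0 ≤ Q x u a ↔ 0 ≤ optimalSafety f h x u a := by
  refine ⟨fun hx => ?_, fun hx => hx.trans (optimalSafety_le_of_fixed h0 h1 hQ x u a)⟩
  obtain ⟨π, hπ⟩ := safePolicies_nonempty Q
  exact (le_policySafety_of_mem_safePolicies h0 hQ le_rfl hv hπ hx).trans
    (policySafety_le_optimalSafety π x u a)

lemma admissible_eq_of_nonneg_iff {P Q : ActionValue X U A}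
    (hPQ : ∀ x u a, 0 ≤ P x u a ↔ 0 ≤ Q x u a) (x : X) : admissible P x = admissible Q x := by
  ext u
  simp only [mem_admissible_iff, hPQ]

lemma robustSet_eq_of_nonneg_iff {P Q : ActionValue X U A}
    (hPQ : ∀ x u a, 0 ≤ P x u a ↔ 0 ≤ Q x u a) : robustSet P = robustSet Q := by
  ext x
  simp only [mem_robustSet_iff, hPQ]

/-! ### Policy iteration for the safety value -/

/-- The old evaluation is a subsolution for the new policy, because the greedy policy turns the
Bellman operator into its own evaluation operator. -/
lemma safety_iteration_le (h0 : 0 ≤ γh) (h1 : γh < 1) {σ σ' : X → U} {P P' : ActionValue X U A}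
    (hP : safetyPolicyOp f h γh σ P = P) (hσ' : IsSafetyImprovement P σ')
    (hP' : safetyPolicyOp f h γh σ' P' = P') : P ≤ P' := by
  refine (isDiscounting_safetyPolicyOp h0 σ').le_of_sub_super h0 h1 ?_ hP'.le
  rw [hσ'.safetyPolicyOp_eq]
  exact hP.ge.trans (safetyPolicyOp_le_bellman h0 σ P)

lemma safety_iteration_le_fixed (h0 : 0 ≤ γh) (h1 : γh < 1) {σ : X → U}
    {P : ActionValue X U A} (hP : safetyPolicyOp f h γh σ P = P)
    (hQ : safetyBellmanOp f h γh Q = Q) : P ≤ Q :=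
  (isDiscounting_safetyBellmanOp h0).le_of_sub_super h0 h1
    (hP.ge.trans (safetyPolicyOp_le_bellman h0 σ P)) hQ.le

lemma safety_iteration_eventually_eq (h0 : 0 ≤ γh) (h1 : γh < 1)
    (hQ : safetyBellmanOp f h γh Q = Q) {σ : ℕ → X → U} {Qh : ℕ → ActionValue X U A}
    (heval : ∀ k, safetyPolicyOp f h γh (σ k) (Qh k) = Qh k)
    (himp : ∀ k, IsSafetyImprovement (Qh k) (σ (k + 1))) : ∀ᶠ k in atTop, Qh k = Q := by
  have hmono : Monotone Qh :=
    monotone_nat_of_le_succ fun k => safety_iteration_le h0 h1 (heval k) (himp k) (heval (k + 1))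
  -- There are finitely many maps `X → U`, and equal policies have equal evaluations.
  have hrepeat : ∃ i j, i < j ∧ Qh i = Qh j := by
    obtain ⟨i, j, hij, hσ⟩ := Finite.exists_ne_map_eq_of_infinite σ
    have heq : Qh i = Qh j := (isDiscounting_safetyPolicyOp h0 (σ i)).fixed_unique h0 h1
      (heval i) (hσ ▸ heval j)
    rcases lt_or_gt_of_ne hij with hlt | hlt
    exacts [⟨i, j, hlt, heq⟩, ⟨j, i, hlt, heq.symm⟩]
  obtain ⟨i, j, hij, heq⟩ := hrepeat
  have hstep : Qh i = Qh (i + 1) :=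
    le_antisymm (hmono i.le_succ) ((hmono (Nat.succ_le_of_lt hij)).trans heq.ge)
  have hfix : safetyBellmanOp f h γh (Qh i) = Qh i := by
    rw [← (himp i).safetyPolicyOp_eq, hstep]
    exact heval (i + 1)
  have hQi : Qh i = Q := (isDiscounting_safetyBellmanOp h0).fixed_unique h0 h1 hfix hQ
  filter_upwards [eventually_ge_atTop i] with k hk
  exact le_antisymm (safety_iteration_le_fixed h0 h1 (heval k) hQ) (hQi.ge.trans (hmono hk))

end Viability

/-! ### Worst-case reward and policy iteration in the constrained game. -/

section Performance

lemma sum_le_sum_add {ι : Type*} [Fintype ι] (ρ : stdSimplex ℝ ι) {p q : ι → ℝ} {c : ℝ}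
    (hpq : ∀ u, 0 < ρ u → p u ≤ q u + c) : ∑ u, ρ u * p u ≤ ∑ u, ρ u * q u + c := by
  have hc : ∑ u, ρ u * (q u + c) = ∑ u, ρ u * q u + c := by
    simp only [mul_add, Finset.sum_add_distrib, ← Finset.sum_mul, stdSimplex.sum_eq_one, one_mul]
  rw [← hc]
  refine Finset.sum_le_sum fun u _ => ?_
  rcases (stdSimplex.zero_le ρ u).eq_or_lt with h0 | hpos
  · simp [← h0]
  · exact mul_le_mul_of_nonneg_left (hpq u hpos) hpos.le

variable {X U A : Type*} [Fintype U] [Fintype A] [Nonempty U] [Nonempty A]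
  {f : X → U → A → X} {r : ActionValue X U A} {γ : ℝ}

/-! ### Worst-case one-shot values -/

/-- Worst-case expected value at `x` of a mixed action that the adversary does not observe. -/
noncomputable def gameValue (Q : ActionValue X U A) (ρ : stdSimplex ℝ U) (x : X) : ℝ :=
  ⨅ a, ∑ u, ρ u * Q x u a

lemma gameValue_le_add {P Q : ActionValue X U A} {ρ : stdSimplex ℝ U} {x : X} {c : ℝ}
    (hPQ : ∀ u, 0 < ρ u → ∀ a, P x u a ≤ Q x u a + c) :
    gameValue P ρ x ≤ gameValue Q ρ x + c :=
  iInf_le_iInf_add fun a => sum_le_sum_add ρ fun u hu => hPQ u hu a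

lemma gameValue_mono {P Q : ActionValue X U A} {ρ : stdSimplex ℝ U} {x : X}
    (hPQ : ∀ u, 0 < ρ u → ∀ a, P x u a ≤ Q x u a) : gameValue P ρ x ≤ gameValue Q ρ x := by
  simpa using gameValue_le_add (c := 0) fun u hu a => (hPQ u hu a).trans (add_zero _).ge

lemma continuous_stdSimplex_apply (u : U) : Continuous fun ρ : stdSimplex ℝ U => ρ u :=
  (continuous_apply u).comp continuous_subtype_val

lemma continuous_gameValue (Q : ActionValue X U A) (x : X) :
    Continuous fun ρ : stdSimplex ℝ U => gameValue Q ρ x := by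
  simp only [gameValue, ← Finset.inf'_univ_eq_ciInf]
  exact Continuous.finset_inf'_apply _ fun a _ =>
    continuous_finsetSum _ fun u _ => (continuous_stdSimplex_apply u).mul continuous_const

lemma isDiscounting_performanceOp (hγ : 0 ≤ γ) (π : Policy X U) :
    IsDiscounting γ (performanceOp f r γ π) := by
  intro P Q c _ hPQ x u a
  have := mul_le_mul_of_nonneg_left
    (gameValue_le_add (ρ := π (f x u a)) fun u' _ a' => hPQ (f x u a) u' a') hγ
  simp only [gameValue] at this
  simp only [performanceOp]
  linarith

/-! ### The value of a policy is the fixed point of its self-consistency operator -/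

/-- Self-consistency operator of a pair of policies. -/
noncomputable def pairOp (f : X → U → A → X) (r : ActionValue X U A) (γ : ℝ)
    (π : Policy X U) (μ : Policy X A) (Q : ActionValue X U A) : ActionValue X U A :=
  fun x u a => r x u a + γ * stepExpectation f π μ Q x u a

lemma stepExpectation_le_add {π : Policy X U} {μ : Policy X A} {P Q : ActionValue X U A} {c : ℝ}
    (hPQ : ∀ x u a, P x u a ≤ Q x u a + c) (x : X) (u : U) (a : A) :
    stepExpectation f π μ P x u a ≤ stepExpectation f π μ Q x u a + c :=
  sum_le_sum_add _ fun _ _ => sum_le_sum_add _ fun _ _ => hPQ _ _ _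

lemma isDiscounting_pairOp (hγ : 0 ≤ γ) (π : Policy X U) (μ : Policy X A) :
    IsDiscounting γ (pairOp f r γ π μ) := by
  intro P Q c _ hPQ x u a
  have := mul_le_mul_of_nonneg_left (stepExpectation_le_add (f := f) (π := π) (μ := μ) hPQ x u a) hγ
  simp only [pairOp]
  linarith

variable [Fintype X]

lemma exists_iterate_stepExpectation_bound (f : X → U → A → X) (r : ActionValue X U A)
    (π : Policy X U) (μ : Policy X A) :
    ∃ B, ∀ t x u a, |(stepExpectation f π μ)^[t] r x u a| ≤ B := by
  obtain ⟨B, hB⟩ := Finite.bddAbove_range (fun i : X × U × A => |r i.1 i.2.1 i.2.2|)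
  have hzero : ∀ x u a, stepExpectation f π μ (fun _ _ _ => 0) x u a = 0 := fun x u a => by
    simp [stepExpectation]
  refine ⟨B, fun t => ?_⟩
  induction t with
  | zero => exact fun x u a => hB ⟨(x, u, a), rfl⟩
  | succ t ih =>
    intro x u a
    rw [Function.iterate_succ_apply', abs_le]
    have h₁ := stepExpectation_le_add (f := f) (π := π) (μ := μ)
      (P := (stepExpectation f π μ)^[t] r) (Q := fun _ _ _ => 0) (c := B)
      (fun x u a => by linarith [(abs_le.1 (ih x u a)).2]) x u a
    have h₂ := stepExpectation_le_add (f := f) (π := π) (μ := μ)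
      (P := fun _ _ _ => 0) (Q := (stepExpectation f π μ)^[t] r) (c := B)
      (fun x u a => by linarith [(abs_le.1 (ih x u a)).1]) x u a
    rw [hzero] at h₁ h₂
    constructor <;> linarith

lemma summable_pairValue (h0 : 0 ≤ γ) (h1 : γ < 1) (π : Policy X U) (μ : Policy X A)
    (x : X) (u : U) (a : A) :
    Summable fun t : ℕ => γ ^ t * ((stepExpectation f π μ)^[t] r) x u a := by
  obtain ⟨B, hB⟩ := exists_iterate_stepExpectation_bound f r π μ
  refine Summable.of_norm_bounded ((summable_geometric_of_lt_one h0 h1).mul_right B) fun t => ?_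
  rw [Real.norm_eq_abs, abs_mul, abs_of_nonneg (pow_nonneg h0 t)]
  exact mul_le_mul_of_nonneg_left (hB t x u a) (pow_nonneg h0 t)

lemma pairOp_pairValue (h0 : 0 ≤ γ) (h1 : γ < 1) (π : Policy X U) (μ : Policy X A) :
    pairOp f r γ π μ (pairValue f r γ π μ) = pairValue f r γ π μ := by
  funext x u a
  have hs := fun x u a => (summable_pairValue (f := f) (r := r) h0 h1 π μ x u a).hasSum
  have htail : HasSum (fun t : ℕ => γ ^ (t + 1) * ((stepExpectation f π μ)^[t + 1] r) x u a)
      (γ * stepExpectation f π μ (pairValue f r γ π μ) x u a) := by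
    have hsum := (hasSum_sum (s := Finset.univ) fun u' _ =>
      (hasSum_sum (s := Finset.univ) fun a' _ =>
        (hs (f x u a) u' a').mul_left (μ (f x u a) a')).mul_left (π (f x u a) u')).mul_left γ
    refine (congrArg (HasSum · _) (funext fun t => ?_)).mpr hsum
    rw [Function.iterate_succ_apply', stepExpectation, Finset.mul_sum, Finset.mul_sum]
    refine Finset.sum_congr rfl fun u' _ => ?_
    rw [Finset.mul_sum, Finset.mul_sum, Finset.mul_sum, Finset.mul_sum]
    refine Finset.sum_congr rfl fun a' _ => ?_
    ring
  have := (summable_pairValue (f := f) (r := r) h0 h1 π μ x u a).tsum_eq_zero_add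
  rw [htail.tsum_eq] at this
  simp only [pairOp, pairValue] at this ⊢
  rw [this]
  simp

lemma performanceOp_le_pairOp (hγ : 0 ≤ γ) (π : Policy X U) (μ : Policy X A)
    (Q : ActionValue X U A) : performanceOp f r γ π Q ≤ pairOp f r γ π μ Q := by
  intro x u a
  have hswap : stepExpectation f π μ Q x u a =
      ∑ a', μ (f x u a) a' * ∑ u', π (f x u a) u' * Q (f x u a) u' a' := by
    simp only [stepExpectation, Finset.mul_sum]
    rw [Finset.sum_comm]
    exact Finset.sum_congr rfl fun a' _ => Finset.sum_congr rfl fun u' _ => by ring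
  have hle : gameValue Q (π (f x u a)) (f x u a) ≤ stepExpectation f π μ Q x u a := by
    rw [hswap]
    have hconst : ∑ a', μ (f x u a) a' * gameValue Q (π (f x u a)) (f x u a)
        = gameValue Q (π (f x u a)) (f x u a) := by
      rw [← Finset.sum_mul, stdSimplex.sum_eq_one, one_mul]
    rw [← hconst]
    exact Finset.sum_le_sum fun a' _ => mul_le_mul_of_nonneg_left
      (iInf_le_of_finite (fun a' => ∑ u', π (f x u a) u' * Q (f x u a) u' a') a')
      (stdSimplex.zero_le _ _)
  exact add_le_add le_rfl (mul_le_mul_of_nonneg_left hle hγ)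

/-- The minimizing adversary action depends on the state alone, as the protagonist's draw is not
observed; hence a stationary deterministic adversary attains the minimum at all states at once. -/
lemma exists_pairOp_eq_performanceOp (f : X → U → A → X) (r : ActionValue X U A) (γ : ℝ)
    (π : Policy X U) (Q : ActionValue X U A) :
    ∃ μ : Policy X A, pairOp f r γ π μ Q = performanceOp f r γ π Q := by
  classical
  choose k hk using fun x =>
    exists_eq_ciInf_of_finite (f := fun a => ∑ u, π x u * Q x u a)
  refine ⟨fun x => stdSimplex.vertex (k x), ?_⟩
  funext x u a
  simp [pairOp, performanceOp, stepExpectation, ← hk, Pi.single_apply]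

lemma policyValue_eq_of_fixed (h0 : 0 ≤ γ) (h1 : γ < 1) {π : Policy X U}
    {Q : ActionValue X U A}
    (hQ : performanceOp f r γ π Q = Q) : policyValue f r γ π = Q := by
  have hle : ∀ μ, Q ≤ pairValue f r γ π μ := fun μ =>
    (isDiscounting_pairOp h0 π μ).le_of_sub_super h0 h1
      (hQ.ge.trans (performanceOp_le_pairOp h0 π μ Q)) (pairOp_pairValue h0 h1 π μ).le
  obtain ⟨μ, hμ⟩ := exists_pairOp_eq_performanceOp f r γ π Q
  have hval : pairValue f r γ π μ = Q :=
    (isDiscounting_pairOp h0 π μ).fixed_unique h0 h1 (pairOp_pairValue h0 h1 π μ) (hμ.trans hQ)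
  funext x u a
  refine le_antisymm ?_ (le_ciInf fun μ => hle μ x u a)
  have := ciInf_le (f := fun μ => pairValue f r γ π μ x u a)
    ⟨Q x u a, by rintro _ ⟨μ, rfl⟩; exact hle μ x u a⟩ μ
  exact this.trans_eq (by rw [hval])

lemma performanceOp_policyValue (h0 : 0 ≤ γ) (h1 : γ < 1) (π : Policy X U) :
    performanceOp f r γ π (policyValue f r γ π) = policyValue f r γ π := by
  obtain ⟨Q, hQ⟩ := (isDiscounting_performanceOp (f := f) (r := r) h0 π).exists_fixed h0 h1
  rwa [policyValue_eq_of_fixed h0 h1 hQ]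

/-! ### The constrained game -/

/-- Distributions carried by a set of actions. -/
def carriedBy (s : Set U) : Set (stdSimplex ℝ U) := {ρ | ∀ u, u ∉ s → ρ u = 0}

lemma isClosed_carriedBy (s : Set U) : IsClosed (carriedBy s) := by
  simp only [carriedBy, Set.ofPred_forall]
  exact isClosed_iInter fun u => isClosed_iInter fun _ =>
    isClosed_eq (continuous_stdSimplex_apply u) continuous_const

lemma carriedBy_nonempty {s : Set U} (hs : s.Nonempty) : (carriedBy s).Nonempty := by
  classical
  obtain ⟨v, hv⟩ := hs
  refine ⟨stdSimplex.vertex v, fun u hu => ?_⟩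
  have : u ≠ v := fun huv => hu (huv ▸ hv)
  simp [this]

lemma mem_of_pos_of_mem_carriedBy {s : Set U} {ρ : stdSimplex ℝ U} (hρ : ρ ∈ carriedBy s) {u : U}
    (hu : 0 < ρ u) : u ∈ s := by
  by_contra hn
  exact hu.ne' (hρ u hn)

variable {Qs : ActionValue X U A}

lemma exists_max_gameValue (Q : ActionValue X U A) {x : X} (hx : x ∈ robustSet Qs) :
    ∃ ρ ∈ carriedBy (admissible Qs x), ∀ ρ' ∈ carriedBy (admissible Qs x),
      gameValue Q ρ' x ≤ gameValue Q ρ x := by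
  obtain ⟨u, hu⟩ := mem_robustSet_iff.1 hx
  exact (isClosed_carriedBy _).isCompact.exists_isMaxOn
    (carriedBy_nonempty ⟨u, mem_admissible_iff.2 hu⟩) (continuous_gameValue Q x).continuousOn

open scoped Classical in
/-- Optimal worst-case one-shot value over the distributions carried by the admissible actions at
the states of `robustSet Qs`, and zero elsewhere. -/
noncomputable def constrainedValue (Qs Q : ActionValue X U A) (x : X) : ℝ :=
  if x ∈ robustSet Qs then
    sSup ((fun ρ => gameValue Q ρ x) '' carriedBy (admissible Qs x)) else 0

lemma isGreatest_constrainedValue (Q : ActionValue X U A) {x : X} (hx : x ∈ robustSet Qs) :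
    IsGreatest ((fun ρ => gameValue Q ρ x) '' carriedBy (admissible Qs x))
      (constrainedValue Qs Q x) := by
  obtain ⟨ρ, hρ, hmax⟩ := exists_max_gameValue Q hx
  have hg : IsGreatest ((fun ρ => gameValue Q ρ x) '' carriedBy (admissible Qs x))
      (gameValue Q ρ x) := ⟨⟨ρ, hρ, rfl⟩, by rintro _ ⟨ρ', hρ', rfl⟩; exact hmax ρ' hρ'⟩
  rw [constrainedValue, if_pos hx, hg.csSup_eq]
  exact hg

lemma gameValue_le_constrainedValue (Q : ActionValue X U A) {x : X} (hx : x ∈ robustSet Qs)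
    {ρ : stdSimplex ℝ U} (hρ : ρ ∈ carriedBy (admissible Qs x)) :
    gameValue Q ρ x ≤ constrainedValue Qs Q x :=
  (isGreatest_constrainedValue Q hx).2 ⟨ρ, hρ, rfl⟩

lemma constrainedValue_le_add {P Q : ActionValue X U A} {x : X} {c : ℝ} (hc : 0 ≤ c)
    (hPQ : x ∈ robustSet Qs → ∀ u ∈ admissible Qs x, ∀ a, P x u a ≤ Q x u a + c) :
    constrainedValue Qs P x ≤ constrainedValue Qs Q x + c := by
  by_cases hx : x ∈ robustSet Qs
  · obtain ⟨ρ, hρ, hmax⟩ := (isGreatest_constrainedValue P hx).1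
    rw [← hmax]
    refine (gameValue_le_add fun u hu a =>
      hPQ hx u (mem_of_pos_of_mem_carriedBy hρ hu) a).trans ?_
    linarith [gameValue_le_constrainedValue Q hx hρ]
  -- Off the robust set both values are the default `0`; this is where `0 ≤ c` is needed.
  · simpa [constrainedValue, hx] using hc

/-- Bellman operator of the constrained game. -/
noncomputable def constrainedOp (f : X → U → A → X) (r : ActionValue X U A) (γ : ℝ)
    (Qs Q : ActionValue X U A) : ActionValue X U A :=
  fun x u a => r x u a + γ * constrainedValue Qs Q (f x u a)

lemma isDiscounting_constrainedOp (hγ : 0 ≤ γ) (Qs : ActionValue X U A) :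
    IsDiscounting γ (constrainedOp f r γ Qs) := by
  intro P Q c hc hPQ x u a
  have := mul_le_mul_of_nonneg_left (constrainedValue_le_add (Qs := Qs) (x := f x u a) hc
    fun _ u _ a => hPQ _ u a) hγ
  simp only [constrainedOp]
  linarith

variable {Qo : ActionValue X U A}

/-- The constrained value function bounds the values of a policy on every set of state-action pairs
that is closed under the moves of the policy and consists of admissible actions. -/
lemma le_constrained_of_fixed (h0 : 0 ≤ γ) (h1 : γ < 1) (hQo : constrainedOp f r γ Qs Qo = Qo)
    {π : Policy X U} {Q : ActionValue X U A} (hQ : performanceOp f r γ π Q = Q)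
    {D : X → U → Prop} (hD : ∀ x u, D x u → ∀ a, f x u a ∈ robustSet Qs ∧
      ∀ u', 0 < π (f x u a) u' → u' ∈ admissible Qs (f x u a) ∧ D (f x u a) u')
    {x : X} {u : U} (hx : D x u) (a : A) : Q x u a ≤ Qo x u a := by
  refine le_of_contraction h0 h1 (D := fun x u _ => D x u) ?_ x u a hx
  intro c hc hle x u a hx
  obtain ⟨hr, hu'⟩ := hD x u hx a
  have hρ : π (f x u a) ∈ carriedBy (admissible Qs (f x u a)) := fun u' hn => by
    by_contra hne
    exact hn (hu' u' (lt_of_le_of_ne (stdSimplex.zero_le _ _) (Ne.symm hne))).1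
  have h₁ : gameValue Q (π (f x u a)) (f x u a) ≤ gameValue Qo (π (f x u a)) (f x u a) + c :=
    gameValue_le_add fun v hv b => hle _ _ _ (hu' v hv).2
  have h₂ := mul_le_mul_of_nonneg_left
    (h₁.trans (add_le_add (gameValue_le_constrainedValue Qo hr hρ) le_rfl)) h0
  rw [← hQ, ← hQo]
  simp only [performanceOp, constrainedOp]
  simp only [gameValue] at h₂
  linarith

/-- The comparison runs over the pairs with state in `R` and action in the support of `π`. Allowing
`R` smaller than the robust set covers feasible policies that violate admissibility at unreachable
states. -/
lemma stateValue_le_constrainedValue (h0 : 0 ≤ γ) (h1 : γ < 1)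
    (hQo : constrainedOp f r γ Qs Qo = Qo) {π : Policy X U} {R : Set X} (hR : R ⊆ robustSet Qs)
    (hstep : ∀ x ∈ R, ∀ u, 0 < π x u → u ∈ admissible Qs x ∧ ∀ a, f x u a ∈ R)
    {x : X} (hx : x ∈ R) : stateValue f r γ π x ≤ constrainedValue Qs Qo x := by
  have hle : ∀ u, 0 < π x u → ∀ a, policyValue f r γ π x u a ≤ Qo x u a := fun u hu a =>
    le_constrained_of_fixed h0 h1 hQo (performanceOp_policyValue h0 h1 π)
      (D := fun x u => x ∈ R ∧ 0 < π x u)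
      (fun x u hxu a => ⟨hR ((hstep x hxu.1 u hxu.2).2 a), fun u' hu' =>
        ⟨(hstep _ ((hstep x hxu.1 u hxu.2).2 a) u' hu').1, (hstep x hxu.1 u hxu.2).2 a, hu'⟩⟩)
      ⟨hx, hu⟩ a
  have hρ : π x ∈ carriedBy (admissible Qs x) := fun u hn => by
    by_contra hne
    exact hn (hstep x hx u (lt_of_le_of_ne (stdSimplex.zero_le _ _) (Ne.symm hne))).1
  exact (gameValue_mono hle).trans (gameValue_le_constrainedValue Qo (hR hx) hρ)

lemma stateValue_le_of_mem_invariantPolicies (h0 : 0 ≤ γ) (h1 : γ < 1)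
    (hQo : constrainedOp f r γ Qs Qo = Qo) (hv : IsViable f Qs 0) {π : Policy X U}
    (hπ : π ∈ invariantPolicies Qs) {x : X} (hx : x ∈ robustSet Qs) :
    stateValue f r γ π x ≤ constrainedValue Qs Qo x :=
  stateValue_le_constrainedValue h0 h1 hQo subset_rfl (fun _ hy _ hu =>
    ⟨mem_admissible_of_pos hπ hy hu, hv.mem_robustSet (mem_admissible_of_pos hπ hy hu)⟩) hx

lemma constrainedValue_le_stateValue (h0 : 0 ≤ γ) (h1 : γ < 1)
    (hQo : constrainedOp f r γ Qs Qo = Qo) (hv : IsViable f Qs 0) {π : Policy X U}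
    (hπ : π ∈ invariantPolicies Qs)
    (hopt : ∀ x ∈ robustSet Qs, gameValue Qo (π x) x = constrainedValue Qs Qo x)
    {x : X} (hx : x ∈ robustSet Qs) : constrainedValue Qs Qo x ≤ stateValue f r γ π x := by
  have hle : ∀ x u a, (x ∈ robustSet Qs ∧ u ∈ admissible Qs x) →
      Qo x u a ≤ policyValue f r γ π x u a := by
    refine le_of_contraction h0 h1 (D := fun x u _ => x ∈ robustSet Qs ∧ u ∈ admissible Qs x) ?_
    intro c hc hle x u a hxu
    have hr := hv.mem_robustSet hxu.2 a
    have h₁ : gameValue Qo (π (f x u a)) (f x u a) ≤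
        gameValue (policyValue f r γ π) (π (f x u a)) (f x u a) + c :=
      gameValue_le_add fun v hv b => hle _ _ _ ⟨hr, mem_admissible_of_pos hπ hr hv⟩
    have h₂ := mul_le_mul_of_nonneg_left h₁ h0
    rw [hopt _ hr] at h₂
    rw [← performanceOp_policyValue h0 h1, ← hQo]
    simp only [performanceOp, constrainedOp, gameValue] at h₂ ⊢
    linarith
  rw [← hopt x hx]
  exact gameValue_mono fun u hu a => hle x u a ⟨hx, mem_admissible_of_pos hπ hx hu⟩

/-! ### Convergence of the task policies -/

lemma IsTaskImprovement.mem_invariantPolicies {Q : ActionValue X U A} {σ : X → U}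
    {π : Policy X U} (h : IsTaskImprovement Q Qs σ π) : π ∈ invariantPolicies Qs :=
  fun x hx u hu => (h.1 x hx).1 u hu

lemma IsTaskImprovement.gameValue_eq {Q : ActionValue X U A} {σ : X → U}
    {π : Policy X U} (h : IsTaskImprovement Q Qs σ π) {x : X} (hx : x ∈ robustSet Qs) :
    gameValue Q (π x) x = constrainedValue Qs Q x :=
  (IsGreatest.unique (s := (fun ρ => gameValue Q ρ x) '' carriedBy (admissible Qs x))
    ⟨⟨π x, (h.1 x hx).1, rfl⟩, by rintro _ ⟨ρ, hρ, rfl⟩; exact (h.1 x hx).2 ρ hρ⟩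
    (isGreatest_constrainedValue Q hx))

lemma task_iteration_le (h0 : 0 ≤ γ) (h1 : γ < 1) (hv : IsViable f Qs 0) {σ : X → U}
    {π π' : Policy X U} {Q Q' : ActionValue X U A} (hπ : π ∈ invariantPolicies Qs)
    (hQ : performanceOp f r γ π Q = Q) (himp : IsTaskImprovement Q Qs σ π')
    (hQ' : performanceOp f r γ π' Q' = Q') {x : X} {u : U} (hx : x ∈ robustSet Qs)
    (hu : u ∈ admissible Qs x) (a : A) : Q x u a ≤ Q' x u a := by
  refine le_of_contraction h0 h1 (D := fun x u _ => x ∈ robustSet Qs ∧ u ∈ admissible Qs x)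
    ?_ x u a ⟨hx, hu⟩
  intro c hc hle x u a hxu
  have hr := hv.mem_robustSet hxu.2 a
  have h₁ : gameValue Q (π (f x u a)) (f x u a) ≤ gameValue Q (π' (f x u a)) (f x u a) :=
    (himp.1 _ hr).2 _ (hπ _ hr)
  have h₂ : gameValue Q (π' (f x u a)) (f x u a) ≤ gameValue Q' (π' (f x u a)) (f x u a) + c :=
    gameValue_le_add fun v hv b =>
      hle _ _ _ ⟨hr, mem_admissible_of_pos himp.mem_invariantPolicies hr hv⟩
  have h₃ := mul_le_mul_of_nonneg_left (h₁.trans h₂) h0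
  rw [← hQ, ← hQ']
  simp only [performanceOp, gameValue] at h₃ ⊢
  linarith

/-- One optimal step contracts the gap between `Qo` and `Q` by `γ`. The new policy attains that step
on `Q`, and its own value `Q'` dominates `Q` on the subgame. -/
lemma task_iteration_contract (h0 : 0 ≤ γ) (h1 : γ < 1) (hv : IsViable f Qs 0)
    (hQo : constrainedOp f r γ Qs Qo = Qo) {σ : X → U}
    {π π' : Policy X U} {Q Q' : ActionValue X U A} (hπ : π ∈ invariantPolicies Qs)
    (hQ : performanceOp f r γ π Q = Q) (himp : IsTaskImprovement Q Qs σ π')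
    (hQ' : performanceOp f r γ π' Q' = Q') {c : ℝ} (hc : 0 ≤ c)
    (hle : ∀ x ∈ robustSet Qs, ∀ u ∈ admissible Qs x, ∀ a, Qo x u a ≤ Q x u a + c) :
    ∀ x ∈ robustSet Qs, ∀ u ∈ admissible Qs x, ∀ a, Qo x u a ≤ Q' x u a + γ * c := by
  intro x hx u hu a
  have hr := hv.mem_robustSet hu a
  have h₁ : constrainedValue Qs Qo (f x u a) ≤ constrainedValue Qs Q (f x u a) + c :=
    constrainedValue_le_add hc fun hr => hle _ hr
  rw [← himp.gameValue_eq hr] at h₁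
  have h₂ : gameValue Q (π' (f x u a)) (f x u a) ≤ gameValue Q' (π' (f x u a)) (f x u a) :=
    gameValue_mono fun v hv' b => task_iteration_le h0 h1 hv hπ hQ himp hQ' hr
      (mem_admissible_of_pos himp.mem_invariantPolicies hr hv') b
  have h₃ := mul_le_mul_of_nonneg_left (h₁.trans (add_le_add h₂ le_rfl)) h0
  rw [← hQ', ← hQo]
  simp only [performanceOp, constrainedOp, gameValue] at h₃ ⊢
  linarith

/-- The one-shot values of the task policies in the optimal constrained game, and their state
values, converge to the constrained value. -/
lemma task_iteration_tendsto (h0 : 0 ≤ γ) (h1 : γ < 1) (hv : IsViable f Qs 0)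
    (hQo : constrainedOp f r γ Qs Qo = Qo) {π : ℕ → Policy X U} {Q : ℕ → ActionValue X U A}
    (heval : ∀ j, performanceOp f r γ (π j) (Q j) = Q j)
    (himp : ∀ᶠ j in atTop, ∃ σ, IsTaskImprovement (Q j) Qs σ (π (j + 1)))
    {x : X} (hx : x ∈ robustSet Qs) :
    Tendsto (fun j => gameValue Qo (π j x) x) atTop (𝓝 (constrainedValue Qs Qo x)) ∧
      Tendsto (fun j => stateValue f r γ (π j) x) atTop (𝓝 (constrainedValue Qs Qo x)) := by
  obtain ⟨J, hJ⟩ := eventually_atTop.1 himp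
  choose! σ hσ using hJ
  -- Improvement number `j` produces policy `j + 1`, so invariance is only known from `J + 1` on.
  have hinv : ∀ m, π (J + 1 + m) ∈ invariantPolicies Qs := fun m => by
    have := (hσ (J + m) (by omega)).mem_invariantPolicies
    rwa [show J + m + 1 = J + 1 + m by omega] at this
  have himp' : ∀ m, IsTaskImprovement (Q (J + 1 + m)) Qs (σ (J + 1 + m)) (π (J + 1 + m + 1)) :=
    fun m => hσ _ (by omega)
  obtain ⟨B, hB⟩ := Finite.bddAbove_range
    (fun i : X × U × A => Qo i.1 i.2.1 i.2.2 - Q (J + 1) i.1 i.2.1 i.2.2)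
  have hB0 : 0 ≤ max B 0 := le_max_right _ _
  have hgap : ∀ m, ∀ x ∈ robustSet Qs, ∀ u ∈ admissible Qs x, ∀ a,
      Qo x u a ≤ Q (J + 1 + m) x u a + γ ^ m * max B 0 := by
    intro m
    induction m with
    | zero =>
      intro x _ u _ a
      have := hB ⟨(x, u, a), rfl⟩
      simp only at this
      simp only [add_zero, pow_zero, one_mul]
      linarith [le_max_left B 0]
    | succ m ih =>
      have := task_iteration_contract h0 h1 hv hQo (hinv m) (heval _) (himp' m) (heval _)
        (by positivity) ih
      rwa [← mul_assoc, ← pow_succ'] at this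
  -- This lower bound squeezes both sequences, since on the subgame `Q (J + 1 + m)` lies below `Qo`
  -- and below the value of the next policy.
  have hlow : ∀ m, constrainedValue Qs Qo x - γ ^ m * max B 0 ≤
      gameValue (Q (J + 1 + m)) (π (J + 1 + m + 1) x) x := fun m => by
    rw [(himp' m).gameValue_eq hx]
    linarith [constrainedValue_le_add (Qs := Qs) (x := x) (P := Qo) (Q := Q (J + 1 + m))
      (c := γ ^ m * max B 0) (by positivity) fun hx => hgap m x hx]
  have hpos : ∀ m u, 0 < π (J + 1 + m + 1) x u → u ∈ admissible Qs x := fun m u hu =>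
    mem_admissible_of_pos (himp' m).mem_invariantPolicies hx hu
  have hlim : Tendsto (fun m : ℕ => constrainedValue Qs Qo x - γ ^ m * max B 0) atTop
      (𝓝 (constrainedValue Qs Qo x)) := by
    simpa using ((tendsto_pow_atTop_nhds_zero_of_lt_one h0 h1).mul_const (max B 0)).const_sub
      (constrainedValue Qs Qo x)
  have hshift : ∀ {g : ℕ → ℝ} {l : Filter ℝ},
      Tendsto (fun m => g (J + 1 + m + 1)) atTop l → Tendsto g atTop l := fun {g l} hg => by
    refine (tendsto_add_atTop_iff_nat (J + 2)).1 (hg.congr fun m => ?_)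
    congr 1
    omega
  constructor
  · refine hshift (tendsto_of_tendsto_of_tendsto_of_le_of_le hlim tendsto_const_nhds
      (fun m => (hlow m).trans (gameValue_mono fun u hu a => ?_)) fun m =>
        gameValue_le_constrainedValue Qo hx ((himp' m).mem_invariantPolicies x hx))
    exact le_constrained_of_fixed h0 h1 hQo (heval (J + 1 + m))
      (D := fun x u => u ∈ admissible Qs x)
      (fun x u hu a => ⟨hv.mem_robustSet hu a, fun u' hu' => by
        have := mem_admissible_of_pos (hinv m) (hv.mem_robustSet hu a) hu'
        exact ⟨this, this⟩⟩) (hpos m u hu) a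
  · refine hshift (tendsto_of_tendsto_of_tendsto_of_le_of_le hlim tendsto_const_nhds
      (fun m => (hlow m).trans ?_) fun m =>
        stateValue_le_of_mem_invariantPolicies h0 h1 hQo hv (himp' m).mem_invariantPolicies hx)
    have hval := policyValue_eq_of_fixed h0 h1 (heval (J + 1 + m + 1))
    change _ ≤ gameValue (policyValue f r γ (π (J + 1 + m + 1))) _ x
    rw [hval]
    exact gameValue_mono fun u hu a => task_iteration_le h0 h1 hv (hinv m) (heval _) (himp' m)
      (heval _) hx (hpos m u hu) a

end Performance

/-! ### Feasibility, solutions and convergence for the twofold problem; existence of runs. -/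

section Twofold

variable {X U A : Type*} [Fintype X] [Fintype U] [Fintype A] [Nonempty U] [Nonempty A]
  {f : X → U → A → X} {h : X → ℝ} {r : ActionValue X U A} {γ γh : ℝ} {Qs Qo : ActionValue X U A}

/-! ### Feasible policies -/

lemma feasible_of_mem_invariantPolicies (d : stdSimplex ℝ X) {π : Policy X U}
    (hπ : π ∈ invariantPolicies Qs) : Feasible f d Qs π :=
  fun _ _ _ hpos t ht => mem_admissible_of_pos hπ ht (hpos t)

lemma stateValue_le_of_feasible (h0 : 0 ≤ γ) (h1 : γ < 1)
    (hQo : constrainedOp f r γ Qs Qo = Qo) (hv : IsViable f Qs 0) {d : stdSimplex ℝ X}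
    {π : Policy X U} (hπ : Feasible f d Qs π) {x : X} (hd : 0 < d x) (hx : x ∈ robustSet Qs) :
    stateValue f r γ π x ≤ constrainedValue Qs Qo x := by
  -- `R` collects the robust states from which every path of `π` obeys the constraint; prepending a
  -- move shows that it is closed under `π` and any adversary.
  let R : Set X := {y | y ∈ robustSet Qs ∧ ∀ τ, IsPath f π τ → (τ 0).1 = y →
    ∀ t, (τ t).1 ∈ robustSet Qs → 0 ≤ ⨅ a, Qs (τ t).1 (τ t).2.1 a}
  have hstep : ∀ y ∈ R, ∀ u, 0 < π y u → u ∈ admissible Qs y ∧ ∀ a, f y u a ∈ R := by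
    intro y hy u hu
    have hadm : u ∈ admissible Qs y := by
      let a₀ : A := Classical.arbitrary A
      -- The constraint speaks of infinite trajectories, so the first action must be continued
      -- somehow before it can be tested.
      obtain ⟨τ, hτ, hτ0⟩ := exists_isPath f π (f y u a₀)
      exact hy.2 _ (hτ.cons hτ0 hu) rfl 0 hy.1
    exact ⟨hadm, fun a => ⟨hv.mem_robustSet hadm a, fun τ hτ hτ0 t ht =>
      hy.2 _ (hτ.cons hτ0 hu) rfl (t + 1) ht⟩⟩
  refine stateValue_le_constrainedValue h0 h1 hQo (R := R) (fun y hy => hy.1) hstep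
    ⟨hx, fun τ hτ hτ0 t ht => hπ τ (by rwa [hτ0]) hτ.1 hτ.2 t ht⟩

/-! ### Solutions of the twofold problem -/

/-- Safe policies that are optimal in the constrained game at every state of the robust set. -/
def optimalPolicies (Qs Qo : ActionValue X U A) : Set (Policy X U) :=
  {π | π ∈ safePolicies Qs ∧
    ∀ x ∈ robustSet Qs, gameValue Qo (π x) x = constrainedValue Qs Qo x}

lemma optimalPolicies_nonempty (Qs Qo : ActionValue X U A) :
    (optimalPolicies Qs Qo).Nonempty := by
  classical
  obtain ⟨π, hπ, σ, hσ, hout⟩ := safePolicies_nonempty Qs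
  have hex : ∀ x, ∃ ρ, x ∈ robustSet Qs → ρ ∈ carriedBy (admissible Qs x) ∧
      gameValue Qo ρ x = constrainedValue Qs Qo x := fun x => by
    by_cases hx : x ∈ robustSet Qs
    · obtain ⟨ρ, hρ, heq⟩ := (isGreatest_constrainedValue Qo hx).1
      exact ⟨ρ, fun _ => ⟨hρ, heq⟩⟩
    · exact ⟨π x, fun hx' => absurd hx' hx⟩
  choose ρ hρ using hex
  refine ⟨fun x => if x ∈ robustSet Qs then ρ x else π x,
    ⟨fun x hx u hu => ?_, σ, hσ, fun x hx => ?_⟩, fun x hx => ?_⟩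
  · simp only [if_pos hx]
    exact (hρ x hx).1 u hu
  · simp only [if_neg hx]
    exact hout x hx
  · simp only [if_pos hx]
    exact (hρ x hx).2

lemma stateValue_eq_of_mem_optimalPolicies (h0 : 0 ≤ γ) (h1 : γ < 1)
    (hQo : constrainedOp f r γ Qs Qo = Qo) (hv : IsViable f Qs 0) {π : Policy X U}
    (hπ : π ∈ optimalPolicies Qs Qo) {x : X} (hx : x ∈ robustSet Qs) :
    stateValue f r γ π x = constrainedValue Qs Qo x :=
  le_antisymm (stateValue_le_of_mem_invariantPolicies h0 h1 hQo hv hπ.1.1 hx)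
    (constrainedValue_le_stateValue h0 h1 hQo hv hπ.1.1 hπ.2 hx)

lemma isGreatest_stateValue (h0 : 0 ≤ γ) (h1 : γ < 1)
    (hQo : constrainedOp f r γ Qs Qo = Qo) (hv : IsViable f Qs 0) {x : X}
    (hx : x ∈ robustSet Qs) :
    IsGreatest ((fun p => stateValue f r γ p x) '' invariantPolicies Qs)
      (constrainedValue Qs Qo x) := by
  obtain ⟨π, hπ⟩ := optimalPolicies_nonempty Qs Qo
  refine ⟨⟨π, hπ.1.1, stateValue_eq_of_mem_optimalPolicies h0 h1 hQo hv hπ hx⟩, ?_⟩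
  rintro _ ⟨p, hp, rfl⟩
  exact stateValue_le_of_mem_invariantPolicies h0 h1 hQo hv hp hx

/-- The objective is compared state by state, only where `d` is positive: there feasibility bounds
the reward term, while the safety term is bounded for all policies. -/
lemma optimalPolicies_subset_solutions (h0 : 0 ≤ γ) (h1 : γ < 1) (hh0 : 0 ≤ γh) (hh1 : γh < 1)
    (hQs : safetyBellmanOp f h γh Qs = Qs) (hQo : constrainedOp f r γ Qs Qo = Qo)
    (hv : IsViable f Qs 0) (hvh : ∀ y, IsViable f Qs (h y)) (d : stdSimplex ℝ X) :
    optimalPolicies Qs Qo ⊆ solutions f h r γ d Qs := by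
  intro π hπ
  refine ⟨feasible_of_mem_invariantPolicies d hπ.1.1, fun p hp => ?_⟩
  refine (sum_le_sum_add (c := 0) d fun x hd => ?_).trans (add_zero _).le
  rw [add_zero]
  by_cases hx : x ∈ robustSet Qs
  · have := stateValue_le_of_feasible h0 h1 hQo hv hp hd hx
    simpa [hx, stateValue_eq_of_mem_optimalPolicies h0 h1 hQo hv hπ hx] using this
  · simpa [hx] using stateSafety_le_of_mem_safePolicies hh0 hh1 hQs hvh hπ.1 hx p

lemma tendsto_objective (h0 : 0 ≤ γ) (h1 : γ < 1) (hh0 : 0 ≤ γh) (hh1 : γh < 1)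
    (hQs : safetyBellmanOp f h γh Qs = Qs) (hQo : constrainedOp f r γ Qs Qo = Qo)
    (hv : IsViable f Qs 0) (hvh : ∀ y, IsViable f Qs (h y)) (d : stdSimplex ℝ X)
    {π : ℕ → Policy X U} (hsafe : ∀ᶠ j in atTop, π j ∈ safePolicies Qs)
    (hval : ∀ x ∈ robustSet Qs,
      Tendsto (fun j => stateValue f r γ (π j) x) atTop (𝓝 (constrainedValue Qs Qo x)))
    {p : Policy X U} (hp : p ∈ solutions f h r γ d Qs) :
    Tendsto (fun j => objective f h r γ d Qs (π j)) atTop (𝓝 (objective f h r γ d Qs p)) := by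
  obtain ⟨q, hq⟩ := optimalPolicies_nonempty Qs Qo
  have hqs := optimalPolicies_subset_solutions h0 h1 hh0 hh1 hQs hQo hv hvh d hq
  rw [le_antisymm (hqs.2 p hp.1) (hp.2 q hqs.1)]
  refine tendsto_finsetSum _ fun x _ => Tendsto.const_mul _ ?_
  by_cases hx : x ∈ robustSet Qs
  · simpa [hx, stateValue_eq_of_mem_optimalPolicies h0 h1 hQo hv hq hx] using hval x hx
  · refine tendsto_const_nhds.congr' ?_
    filter_upwards [hsafe] with j hj
    simpa [hx] using le_antisymm
      (stateSafety_le_of_mem_safePolicies hh0 hh1 hQs hvh hj hx q)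
      (stateSafety_le_of_mem_safePolicies hh0 hh1 hQs hvh hq.1 hx (π j))

lemma isClosed_safePolicies (Q : ActionValue X U A) : IsClosed (safePolicies Q) := by
  have h₁ : IsClosed (invariantPolicies Q) := by
    have : invariantPolicies Q =
        ⋂ x ∈ robustSet Q, (fun π : Policy X U => π x) ⁻¹' carriedBy (admissible Q x) := by
      ext π
      simp [invariantPolicies, carriedBy]
    rw [this]
    exact isClosed_biInter fun x _ => (isClosed_carriedBy _).preimage (continuous_apply x)
  have h₂ : safePolicies Q = invariantPolicies Q ∩ ⋃ σ : {σ // IsSafetyImprovement Q σ},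
      ⋂ x ∈ (robustSet Q)ᶜ, {π : Policy X U | π x (σ.1 x) = 1} := by
    ext π
    simp [safePolicies]
  rw [h₂]
  exact h₁.inter (isClosed_iUnion_of_finite fun σ => isClosed_biInter fun x _ =>
    isClosed_eq ((continuous_stdSimplex_apply _).comp (continuous_apply x)) continuous_const)

/-- A subsequence staying away from `optimalPolicies` would have a limit point by compactness, and
that limit is optimal. Measuring optimality by one-shot values of the fixed function `Qo` avoids
continuity of `stateValue` in the policy. -/
lemma tendsto_infDist_solutions (h0 : 0 ≤ γ) (h1 : γ < 1) (hh0 : 0 ≤ γh) (hh1 : γh < 1)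
    (hQs : safetyBellmanOp f h γh Qs = Qs) (hQo : constrainedOp f r γ Qs Qo = Qo)
    (hv : IsViable f Qs 0) (hvh : ∀ y, IsViable f Qs (h y)) (d : stdSimplex ℝ X)
    {π : ℕ → Policy X U} (hsafe : ∀ᶠ j in atTop, π j ∈ safePolicies Qs)
    (hgame : ∀ x ∈ robustSet Qs,
      Tendsto (fun j => gameValue Qo (π j x) x) atTop (𝓝 (constrainedValue Qs Qo x))) :
    Tendsto (fun j => Metric.infDist (π j) (solutions f h r γ d Qs)) atTop (𝓝 0) := by
  have hsub := optimalPolicies_subset_solutions h0 h1 hh0 hh1 hQs hQo hv hvh d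
  have hne := optimalPolicies_nonempty Qs Qo
  suffices hmain : Tendsto (fun j => Metric.infDist (π j) (optimalPolicies Qs Qo)) atTop (𝓝 0) from
    squeeze_zero (fun _ => Metric.infDist_nonneg)
      (fun _ => Metric.infDist_le_infDist_of_subset hsub hne) hmain
  by_contra hcon
  obtain ⟨ε, hε, hfreq⟩ : ∃ ε > 0, ∃ᶠ j in atTop,
      ε ≤ Metric.infDist (π j) (optimalPolicies Qs Qo) := by
    by_contra! hall
    refine hcon (Metric.tendsto_nhds.2 fun ε hε => ?_)
    filter_upwards [hall ε hε] with j hj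
    rwa [Real.dist_eq, sub_zero, abs_of_nonneg Metric.infDist_nonneg]
  obtain ⟨φ, hφ, hfar⟩ := extraction_of_frequently_atTop (hfreq.and_eventually hsafe)
  obtain ⟨p, ψ, hψ, hp⟩ := CompactSpace.tendsto_subseq (fun j => π (φ j))
  have hsub_atTop : Tendsto (fun j => φ (ψ j)) atTop atTop :=
    hφ.tendsto_atTop.comp hψ.tendsto_atTop
  have hpmem : p ∈ optimalPolicies Qs Qo := by
    refine ⟨(isClosed_safePolicies Qs).mem_of_tendsto hp
      (Eventually.of_forall fun j => (hfar (ψ j)).2), fun x hx => ?_⟩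
    have hc : Continuous fun π : Policy X U => gameValue Qo (π x) x :=
      (continuous_gameValue Qo x).comp (continuous_apply x)
    exact tendsto_nhds_unique ((hc.tendsto p).comp hp) ((hgame x hx).comp hsub_atTop)
  have hlim := ((Metric.continuous_infDist_pt (optimalPolicies Qs Qo)).tendsto p).comp hp
  rw [Metric.infDist_zero_of_mem hpmem] at hlim
  exact absurd (ge_of_tendsto' hlim fun j => (hfar (ψ j)).1) (not_le.2 hε)

/-! ### Executability -/

lemma exists_isTaskImprovement (Q Qh : ActionValue X U A) (σ : X → U) :
    ∃ π, IsTaskImprovement Q Qh σ π := by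
  classical
  have hex : ∀ x, ∃ ρ, x ∈ robustSet Qh → ρ ∈ carriedBy (admissible Qh x) ∧
      ∀ ρ' ∈ carriedBy (admissible Qh x), gameValue Q ρ' x ≤ gameValue Q ρ x := fun x => by
    by_cases hx : x ∈ robustSet Qh
    · obtain ⟨ρ, hρ⟩ := exists_max_gameValue Q hx
      exact ⟨ρ, fun _ => hρ⟩
    · exact ⟨stdSimplex.vertex (σ x), fun hx' => absurd hx' hx⟩
  choose ρ hρ using hex
  refine ⟨fun x => if x ∈ robustSet Qh then ρ x else stdSimplex.vertex (σ x),
    fun x hx => ?_, fun x hx => ?_⟩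
  · simp only [if_pos hx]
    exact hρ x hx
  · simp [if_neg hx]

lemma exists_isRun (h0 : 0 ≤ γ) (h1 : γ < 1) (hh0 : 0 ≤ γh) (hh1 : γh < 1)
    (hQs : safetyBellmanOp f h γh Qs = Qs) (hne : (robustSet Qs).Nonempty) {n : ℕ} (hn : 1 ≤ n)
    (π₀ : Policy X U) (σ₀ : X → U) :
    ∃ π Q σ Qh K, IsRun f h r γh γ n π₀ σ₀ π Q σ Qh K := by
  classical
  choose eval heval using fun σ : X → U =>
    (isDiscounting_safetyPolicyOp (A := A) (f := f) (h := h) hh0 σ).exists_fixed hh0 hh1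
  choose imp himp using fun Q : ActionValue X U A => exists_isSafetyImprovement Q
  let σ : ℕ → X → U := fun k => (fun s => imp (eval s))^[k] σ₀
  have himp' : ∀ k, IsSafetyImprovement (eval (σ k)) (σ (k + 1)) := fun k => by
    simp only [σ, Function.iterate_succ_apply']
    exact himp _
  have hev := safety_iteration_eventually_eq hh0 hh1 hQs (fun k => heval (σ k)) himp'
  have hK : ∃ K, 1 ≤ K ∧ (robustSet (eval (σ (K * n)))).Nonempty := by
    obtain ⟨N, hN⟩ := eventually_atTop.1 hev
    refine ⟨N + 1, by omega, ?_⟩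
    rw [hN _ (by nlinarith)]
    exact hne
  choose teval hteval using fun π : Policy X U =>
    (isDiscounting_performanceOp (f := f) (r := r) h0 π).exists_fixed h0 h1
  choose timp htimp using fun (Q Qh : ActionValue X U A) (σ : X → U) =>
    exists_isTaskImprovement Q Qh σ
  let K := Nat.find hK
  let π : ℕ → Policy X U := fun j => Nat.rec π₀
    (fun j p => timp (teval p) (eval (σ ((K + j) * n))) (σ ((K + j) * n))) j
  refine ⟨π, fun j => teval (π j), σ, fun k => eval (σ k), K, rfl, rfl, fun k => heval _, himp',
    (Nat.find_spec hK).1, (Nat.find_spec hK).2, fun i hi hiK => ?_, fun j => hteval _,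
    fun j => htimp _ _ _⟩
  by_contra hi'
  exact Nat.find_min hK hiK ⟨hi, Set.nonempty_iff_ne_empty.2 hi'⟩

lemma IsRun.eventually_eq (hh0 : 0 ≤ γh) (hh1 : γh < 1)
    (hQs : safetyBellmanOp f h γh Qs = Qs) {n : ℕ} (hn : 1 ≤ n)
    {π₀ : Policy X U} {σ₀ : X → U} {π : ℕ → Policy X U} {Q : ℕ → ActionValue X U A}
    {σ : ℕ → X → U} {Qh : ℕ → ActionValue X U A} {K : ℕ}
    (hrun : IsRun f h r γh γ n π₀ σ₀ π Q σ Qh K) :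
    ∀ᶠ j in atTop, Qh ((K + j) * n) = Qs ∧ IsSafetyImprovement Qs (σ ((K + j) * n)) := by
  obtain ⟨N, hN⟩ := eventually_atTop.1 (safety_iteration_eventually_eq hh0 hh1 hQs
    hrun.safety_evaluation hrun.safety_improvement)
  filter_upwards [eventually_ge_atTop (N + 1)] with j hj
  -- The policy at index `m + 1` is greedy for the evaluation at index `m`, so the value must have
  -- settled one index earlier.
  have hle : N + 1 ≤ (K + j) * n := by nlinarith
  obtain ⟨m, hm⟩ : ∃ m, (K + j) * n = m + 1 := ⟨(K + j) * n - 1, by omega⟩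
  rw [hm] at hle ⊢
  refine ⟨hN _ (by omega), ?_⟩
  have := hrun.safety_improvement m
  rwa [hN m (by omega)] at this

end Twofold

end ConstrainedGame

/-! ### Assembly. -/

theorem mainTheorem1 {X U A : Type*} [Fintype X] [Fintype U] [Fintype A] [Nonempty U] [Nonempty A]
    (f : X → U → A → X) (h : X → ℝ)
    (hsafe : (robustSet (optimalSafety f h)).Nonempty) :
    ∃ γ₀ : ℝ, γ₀ < 1 ∧ ∀ γh : ℝ, 0 < γh → γh < 1 →
      ∃ Qs : ActionValue X U A,
        -- `Qs` is the unique fixed point of the safety Bellman operator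
        (∀ Q, safetyBellmanOp f h γh Q = Q ↔ Q = Qs) ∧
        -- for `γh` close to `1` it yields the true maximal robust invariant set and actions
        (γ₀ < γh → robustSet Qs = robustSet (optimalSafety f h) ∧
          ∀ x, admissible Qs x = admissible (optimalSafety f h) x) ∧
        ∀ (r : ActionValue X U A) (γ : ℝ), 0 ≤ γ → γ < 1 → ∀ n : ℕ, 1 ≤ n →
        ∀ (π₀ : Policy X U) (σ₀ : X → U),
          -- the algorithm can be executed from any initial policies
          (∃ π Q σ Qh K, IsRun f h r γh γ n π₀ σ₀ π Q σ Qh K) ∧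
          ∀ π Q σ Qh K, IsRun f h r γh γ n π₀ σ₀ π Q σ Qh K →
            -- monotone convergence of the safety policy
            (∀ k, Qh k ≤ Qh (k + 1)) ∧
            (∀ k, Qh k ≤ Qs) ∧
            (∀ᶠ k in atTop, Qh k = Qs) ∧
            (∀ k, robustSet (Qh k) ⊆ robustSet (Qh (k + 1))) ∧
            (∀ᶠ k in atTop, robustSet (Qh k) = robustSet Qs) ∧
            (γ₀ < γh →
              -- the task policy becomes invariant, and copies a safety policy with value `Qs`
              (∀ᶠ j in atTop, π j ∈ invariantPolicies Qs) ∧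
              (∀ᶠ j in atTop, Qh ((K + j) * n) = Qs ∧
                ∀ x, x ∉ robustSet Qs → π (j + 1) x (σ ((K + j) * n) x) = 1) ∧
              -- inside: worst-case reward optimality among the invariant policies, in the limit
              (∀ x ∈ robustSet Qs, ∃ v : ℝ,
                IsGreatest ((fun p => stateValue f r γ p x) '' invariantPolicies Qs) v ∧
                Tendsto (fun j => stateValue f r γ (π j) x) atTop (𝓝 v)) ∧
              -- outside: maximal safety value among all policies
              (∀ᶠ j in atTop, ∀ x, x ∉ robustSet Qs →
                ∀ p : Policy X U, stateSafety f h p x ≤ stateSafety f h (π j) x) ∧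
              -- convergence to the solutions of the twofold problem
              ∀ d : stdSimplex ℝ X,
                (solutions f h r γ d Qs).Nonempty ∧
                (∀ᶠ j in atTop, Feasible f d Qs (π j)) ∧
                (∀ p ∈ solutions f h r γ d Qs,
                  Tendsto (fun j => objective f h r γ d Qs (π j)) atTop
                    (𝓝 (objective f h r γ d Qs p))) ∧
                Tendsto (fun j => Metric.infDist (π j) (solutions f h r γ d Qs)) atTop (𝓝 0)) := by
  classical
  obtain ⟨γ₀, hγ₀, hviab⟩ := exists_viability_threshold f h
  refine ⟨γ₀, hγ₀, fun γh hh0 hh1 => ?_⟩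
  have hT := isDiscounting_safetyBellmanOp (f := f) (h := h) hh0.le
  obtain ⟨Qs, hQs⟩ := hT.exists_fixed hh0.le hh1
  -- As `optimalSafety` lies below `Qs` for every `γh`, the first block of safety iterations
  -- terminates even below the threshold.
  have hne : (robustSet Qs).Nonempty :=
    hsafe.mono (robustSet_mono (optimalSafety_le_of_fixed hh0.le hh1 hQs))
  refine ⟨Qs, fun Q => ⟨fun hQ => hT.fixed_unique hh0.le hh1 hQ hQs, fun hQ => hQ ▸ hQs⟩,
    fun hlt => ?_, fun r γ h0 h1 n hn π₀ σ₀ => ⟨exists_isRun h0 h1 hh0.le hh1 hQs hne hn π₀ σ₀,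
      fun π Q σ Qh K hrun => ?_⟩⟩
  · have hiff := nonneg_iff_optimalSafety_nonneg hh0.le hh1 hQs (hviab γh hh0 hh1 hlt Qs hQs).1
    exact ⟨robustSet_eq_of_nonneg_iff hiff, admissible_eq_of_nonneg_iff hiff⟩
  have hmono : ∀ k, Qh k ≤ Qh (k + 1) := fun k => safety_iteration_le hh0.le hh1
    (hrun.safety_evaluation k) (hrun.safety_improvement k) (hrun.safety_evaluation (k + 1))
  have hev := safety_iteration_eventually_eq hh0.le hh1 hQs hrun.safety_evaluation
    hrun.safety_improvement
  refine ⟨hmono, fun k => safety_iteration_le_fixed hh0.le hh1 (hrun.safety_evaluation k) hQs, hev,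
    fun k => robustSet_mono (hmono k), hev.mono fun k hk => by rw [hk], fun hlt => ?_⟩
  obtain ⟨hv, hvh⟩ := hviab γh hh0 hh1 hlt Qs hQs
  obtain ⟨Qo, hQo⟩ :=
    (isDiscounting_constrainedOp (f := f) (r := r) h0 Qs).exists_fixed h0 h1
  have hrunev := hrun.eventually_eq hh0.le hh1 hQs hn
  have htask : ∀ᶠ j in atTop, IsTaskImprovement (Q j) Qs (σ ((K + j) * n)) (π (j + 1)) :=
    hrunev.mono fun j hj => hj.1 ▸ hrun.task_improvement j
  have hsafePol : ∀ᶠ j in atTop, π j ∈ safePolicies Qs := by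
    -- Eventual membership is written as convergence to a principal filter, in order to pass from
    -- index `j + 1` to `j`.
    refine (tendsto_add_atTop_iff_nat (f := π) (l := 𝓟 (safePolicies Qs)) 1).1 ?_
      |>.eventually (mem_principal_self _)
    exact tendsto_principal.2 ((htask.and hrunev).mono fun j hj =>
      ⟨hj.1.mem_invariantPolicies, _, hj.2.2, hj.1.2⟩)
  have hconv := fun x (hx : x ∈ robustSet Qs) => task_iteration_tendsto h0 h1 hv hQo
    hrun.task_evaluation (htask.mono fun j hj => ⟨_, hj⟩) hx
  refine ⟨hsafePol.mono fun j hj => hj.1, (htask.and hrunev).mono fun j hj => ⟨hj.2.1, hj.1.2⟩,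
    fun x hx => ⟨_, isGreatest_stateValue h0 h1 hQo hv hx, (hconv x hx).2⟩,
    hsafePol.mono fun j hj x hx p => stateSafety_le_of_mem_safePolicies hh0.le hh1 hQs hvh hj hx p,
    fun d => ⟨(optimalPolicies_nonempty Qs Qo).mono
      (optimalPolicies_subset_solutions h0 h1 hh0.le hh1 hQs hQo hv hvh d),
      hsafePol.mono fun j hj => feasible_of_mem_invariantPolicies d hj.1,
      fun p hp => tendsto_objective h0 h1 hh0.le hh1 hQs hQo hv hvh d hsafePol
        (fun x hx => (hconv x hx).2) hp,
      tendsto_infDist_solutions h0 h1 hh0.le hh1 hQs hQo hv hvh d hsafePol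
        fun x hx => (hconv x hx).1⟩⟩
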